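/- Let $d\ge 1$, let $\Omega\subset\mathbb{R}^d$ be a nonempty bounded convex open set, $T>0$, $0<\alpha<1$. Write $(\cdot,\cdot)$ and $\|\cdot\|$ for the inner product and norm of $L^2(\Omega)$ (scalar or vector valued) and $\|u\|_1=(\|u\|^2+\|\nabla u\|^2)^{1/2}$. Let $b_2$ (a symmetric positive definite $d\times d$ matrix), $b_1$ (a vector) and $b_0$ (a scalar) be smooth functions of $(x,t,s)\in\bar\Omega\times[0,T]\times[0,T]$ and, for $u,v\in H^1_0(\Omega)$, put $$B(t,s,u,v)=(b_2(\cdot,t,s)\nabla u,\nabla v)-(b_1(\cdot,t,s)u,\nabla v)+(b_0(\cdot,t,s)u,v).$$ Data. Let $m_0>0$. Let $u_0$, $f$, $M$ satisfy: (A1) $u_0\in H^2(\Omega)\cap H^1_0(\Omega)$ and $f\in L^\infty(0,T;L^2(\Omega))$, where $f$ is given by an $L^2(\Omega)$-valued function whose values are defined for every $t$; (A2) $M$ is Lipschitz continuous with some constant $L_M$ on $(0,\infty)$ (extended continuously to $0$), $M(s)\ge m_0$ for all $s>0$, and $m_0-4L_MK^2>0$, where $K=\|u_0\|_1+\|f\|_{L^\infty(0,T;L^2(\Omega))}$.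 Discretization. Take a finite conforming family of nondegenerate closed $d$-simplices contained in $\bar\Omega$, such that every vertex lying on the boundary of their union lies on $\partial\Omega$, and let $X_h\subset H^1_0(\Omega)$ be the space of continuous functions that are affine on each simplex and zero outside the union. For $N\ge1$ and a grading parameter $\delta\ge1$ let $t_n=T(n/N)^\delta$ $(0\le n\le N)$, $\tau_n=t_n-t_{n-1}$, $$k_{n,j}=\frac{\tau_j^{-1}}{\Gamma(1-\alpha)}\int_{t_{j-1}}^{t_j}(t_n-s)^{-\alpha}\,ds,\qquad \mathbb{D}_t^\alpha u^n=\sum_{j=1}^n k_{n,j}(u^j-u^{j-1}),\qquad f^n=f(t_n).$$ Let $f_h^n\in X_h$ be the $L^2$-projection of $f^n$, that is $(f_h^n,v_h)=(f^n,v_h)$ for all $v_h\in X_h$. A fully discrete solution is a family $u_h^0,\dots,u_h^N\in X_h$ such that $u_h^0$ is the Ritz projection of $u_0$, that is $(\nabla u_h^0,\nabla v_h)=(\nabla u_0,\nabla v_h)$, such that $$(\mathbb{D}_t^\alpha u_h^1,v_h)+M(\|\nabla u_h^1\|^2)(\nabla u_h^1,\nabla v_h)=(f_h^1,v_h)+\tau_1B(t_1,t_1,u_h^1,v_h),$$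 and such that for $2\le n\le N$ $$(\mathbb{D}_t^\alpha u_h^n,v_h)+M(\|\nabla\tilde u_h^{n-1}\|^2)(\nabla u_h^n,\nabla v_h)=(f_h^n,v_h)+\sum_{j=1}^{n-1}\tau_{j+1}\bar B(t_n,t_j,u_h^j,v_h),$$ each for all $v_h\in X_h$. Here $\tilde u_h^{n-1}=\bigl(1+\tfrac{\tau_n}{\tau_{n-1}}\bigr)u_h^{n-1}-\tfrac{\tau_n}{\tau_{n-1}}u_h^{n-2}$, and $$\bar B(t_n,t_j,u_h^j,v_h)=\tfrac12\bigl[B(t_n,t_j,u_h^j,v_h)+B(t_n,t_{j+1},u_h^{j+1},v_h)\bigr]\quad(1\le j\le n-2),$$ $$\bar B(t_n,t_{n-1},u_h^{n-1},v_h)=B(t_n,t_{n-1},u_h^{n-1},v_h).$$ For $n\ge1$ put $|||u_h^n|||=\|u_h^n\|+\tau_n^{\alpha/2}\|\nabla u_h^n\|$. Theorem. There is $\tau_{\max}>0$, depending only on $\Omega,T,\alpha,m_0,b_0,b_1,b_2$, and for every $\delta\ge1$ there is $C>0$, depending only on these and $\delta$, such that for all $u_0,f,M$ satisfying (A1)–(A2),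 all triangulations as above and all $N\ge1$ with $\tau_1\le\tau_{\max}$, every fully discrete solution satisfies $$\max_{1\le n\le N}|||u_h^n|||\le C\Bigl(\|\nabla u_0\|+\max_{1\le n\le N}\|f^n\|\Bigr).$$ -/

import Mathlib

open MeasureTheory Set Geometry
open scoped ContDiff

noncomputable section

namespace KirchhoffL1

/-- Euclidean space `ℝ^d`. -/
abbrev Eucl (d : ℕ) : Type := EuclideanSpace ℝ (Fin d)

/-- `L²(Ω)`, real valued. -/
abbrev L2 {d : ℕ} (Ω : Set (Eucl d)) : Type := Lp ℝ 2 (volume.restrict Ω)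

/-- `L²(Ω; ℝ^d)`. -/
abbrev L2Vec {d : ℕ} (Ω : Set (Eucl d)) : Type := Lp (Eucl d) 2 (volume.restrict Ω)

/-- `φ ∈ C_c^∞(Ω)`. -/
def IsTestFunction {d : ℕ} (Ω : Set (Eucl d)) (φ : Eucl d → ℝ) : Prop :=
  ContDiff ℝ ∞ φ ∧ HasCompactSupport φ ∧ tsupport φ ⊆ Ω

/-- The pairs `(φ, ∇φ)` with `φ ∈ C_c^∞(Ω)`, as elements of `L²(Ω) × L²(Ω; ℝ^d)`. -/
def testPairs {d : ℕ} (Ω : Set (Eucl d)) : Set (L2 Ω × L2Vec Ω) :=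
  {U | ∃ φ : Eucl d → ℝ, IsTestFunction Ω φ ∧
    U.1 =ᵐ[volume.restrict Ω] φ ∧ U.2 =ᵐ[volume.restrict Ω] gradient φ}

/-- The Sobolev space `H¹₀(Ω)`: the closure of `C_c^∞(Ω)` in the `H¹` norm. An element `v` is stored
as the pair `(v, ∇v)`, so `V.1` is the function and `V.2` is its weak gradient. -/
def H10 {d : ℕ} (Ω : Set (Eucl d)) : Submodule ℝ (L2 Ω × L2Vec Ω) :=
  (Submodule.span ℝ (testPairs Ω)).topologicalClosure

/-- For `U ∈ H¹₀(Ω)`: all second weak partial derivatives lie in `L²(Ω)`, i.e. `U ∈ H²(Ω)`. -/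
def HasL2SecondDerivatives {d : ℕ} {Ω : Set (Eucl d)} (U : L2 Ω × L2Vec Ω) : Prop :=
  ∀ i j : Fin d, ∃ g : L2 Ω, ∀ φ : Eucl d → ℝ, IsTestFunction Ω φ →
    ∫ x in Ω, U.2 x i * gradient φ x j = - ∫ x in Ω, g x * φ x

/-- The `H¹(Ω)` norm `(‖u‖² + ‖∇u‖²)^{1/2}`. -/
def h1Norm {d : ℕ} {Ω : Set (Eucl d)} (U : L2 Ω × L2Vec Ω) : ℝ :=
  Real.sqrt (‖U.1‖ ^ 2 + ‖U.2‖ ^ 2)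

/-- The coefficients of the second order memory operator
`b(x,t,s) u = -∇·(b₂ ∇u) + ∇·(b₁ u) + b₀ u`. -/
structure MemoryCoeffs (d : ℕ) where
  b2 : Eucl d → ℝ → ℝ → Matrix (Fin d) (Fin d) ℝ
  b1 : Eucl d → ℝ → ℝ → Eucl d
  b0 : Eucl d → ℝ → ℝ → ℝ

/-- The coefficients are smooth on `Ω̄ × [0,T] × [0,T]` and `b₂` is symmetric positive definite
there (for real matrices `Matrix.PosDef` includes symmetry). -/
structure MemoryCoeffs.Admissible {d : ℕ} (b : MemoryCoeffs d) (Ω : Set (Eucl d)) (T : ℝ) :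
    Prop where
  smooth_b2 : ∀ i j, ContDiffOn ℝ ∞ (fun p : Eucl d × ℝ × ℝ => b.b2 p.1 p.2.1 p.2.2 i j)
    (closure Ω ×ˢ Icc 0 T ×ˢ Icc 0 T)
  smooth_b1 : ContDiffOn ℝ ∞ (fun p : Eucl d × ℝ × ℝ => b.b1 p.1 p.2.1 p.2.2)
    (closure Ω ×ˢ Icc 0 T ×ˢ Icc 0 T)
  smooth_b0 : ContDiffOn ℝ ∞ (fun p : Eucl d × ℝ × ℝ => b.b0 p.1 p.2.1 p.2.2)
    (closure Ω ×ˢ Icc 0 T ×ˢ Icc 0 T)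
  posDef : ∀ x ∈ closure Ω, ∀ t ∈ Icc 0 T, ∀ s ∈ Icc 0 T, (b.b2 x t s).PosDef

/-- `B(t,s,u,v) = (b₂(·,t,s)∇u, ∇v) - (b₁(·,t,s)u, ∇v) + (b₀(·,t,s)u, v)`. -/
def MemoryCoeffs.form {d : ℕ} (b : MemoryCoeffs d) {Ω : Set (Eucl d)} (t s : ℝ)
    (U V : L2 Ω × L2Vec Ω) : ℝ :=
  (∫ x in Ω, ∑ i, ∑ j, b.b2 x t s i j * U.2 x j * V.2 x i)
    - (∫ x in Ω, U.1 x * ∑ i, b.b1 x t s i * V.2 x i)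
    + ∫ x in Ω, b.b0 x t s * U.1 x * V.1 x

/-- Assumption (A1): `u₀ ∈ H²(Ω) ∩ H¹₀(Ω)` and `f ∈ L^∞(0,T; L²(Ω))`. -/
structure AssumptionA1 {d : ℕ} (Ω : Set (Eucl d)) (T : ℝ) (u0 : L2 Ω × L2Vec Ω)
    (f : ℝ → L2 Ω) : Prop where
  mem_H10 : u0 ∈ H10 Ω
  mem_H2 : HasL2SecondDerivatives u0
  memLp : MemLp f ⊤ (volume.restrict (Ioo 0 T))

/-- `K = ‖u₀‖₁ + ‖f‖_{L^∞(0,T;L²(Ω))}`. -/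
def dataSize {d : ℕ} {Ω : Set (Eucl d)} (T : ℝ) (u0 : L2 Ω × L2Vec Ω) (f : ℝ → L2 Ω) : ℝ :=
  h1Norm u0 + (eLpNorm f ⊤ (volume.restrict (Ioo 0 T))).toReal

/-- Assumption (A2) with the standing Lipschitz assumption: `M` is Lipschitz with constant `L`
(on `(0,∞)` and its continuous extension to `0`, which the scheme evaluates if a gradient
vanishes), `M ≥ m₀ > 0` on `(0,∞)`, and `m₀ - 4 L K² > 0`. -/
structure AssumptionA2 {d : ℕ} {Ω : Set (Eucl d)} (T m0 : ℝ) (M : ℝ → ℝ)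
    (u0 : L2 Ω × L2Vec Ω) (f : ℝ → L2 Ω) : Prop where
  pos : 0 < m0
  lower : ∀ s, 0 < s → m0 ≤ M s
  lipschitz : ∃ L : NNReal, LipschitzOnWith L M (Ici 0) ∧
    0 < m0 - 4 * (L : ℝ) * dataSize T u0 f ^ 2

/-- A triangulation into `d`-simplices: a finite nonempty simplicial complex, all of whose faces are
faces of `d`-simplices, with underlying polyhedral set contained in `Ω̄`, and such that the vertices
on the boundary of the polyhedral set lie on `∂Ω`. (If `Ω` is a polytope the polyhedral set can be
`Ω̄`; otherwise it is an inscribed polyhedral approximation of it.) -/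
structure IsTriangulation {d : ℕ} (Ω : Set (Eucl d)) (S : SimplicialComplex ℝ (Eucl d)) :
    Prop where
  finite : S.faces.Finite
  nonempty : S.faces.Nonempty
  pure : ∀ s ∈ S.faces, ∃ t ∈ S.faces, s ⊆ t ∧ t.card = d + 1
  subset : S.space ⊆ closure Ω
  boundary : ∀ x ∈ S.vertices, x ∈ frontier S.space → x ∈ frontier Ω

/-- The finite element space `X_h`: elements of `H¹₀(Ω)` that are continuous, affine on every
simplex, and (when the simplices do not fill `Ω`) zero outside their union. -/
def feSpace {d : ℕ} (Ω : Set (Eucl d)) (S : SimplicialComplex ℝ (Eucl d)) :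
    Submodule ℝ (L2 Ω × L2Vec Ω) where
  carrier := {V | V ∈ H10 Ω ∧ ∃ v : Eucl d → ℝ, Continuous v ∧ V.1 =ᵐ[volume.restrict Ω] v ∧
    (∀ s ∈ S.faces, ∃ l : Eucl d →ᵃ[ℝ] ℝ, EqOn v l (convexHull ℝ (s : Set (Eucl d)))) ∧
    ∀ x, x ∉ S.space → v x = 0}
  zero_mem' := ⟨Submodule.zero_mem _, 0, continuous_zero, Lp.coeFn_zero _ _ _,
    fun _ _ => ⟨0, fun _ _ => rfl⟩, fun _ _ => rfl⟩
  add_mem' := by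
    rintro V W ⟨hV, v, hvc, hv, hva, hv0⟩ ⟨hW, w, hwc, hw, hwa, hw0⟩
    refine ⟨Submodule.add_mem _ hV hW, v + w, hvc.add hwc,
      (Lp.coeFn_add _ _).trans (hv.add hw), ?_, ?_⟩
    · intro s hs
      obtain ⟨l, hl⟩ := hva s hs
      obtain ⟨k, hk⟩ := hwa s hs
      exact ⟨l + k, fun x hx => by simp [hl hx, hk hx]⟩
    · intro x hx
      simp [hv0 x hx, hw0 x hx]
  smul_mem' := by
    rintro c V ⟨hV, v, hvc, hv, hva, hv0⟩
    refine ⟨Submodule.smul_mem _ c hV, c • v, hvc.const_smul c,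
      (Lp.coeFn_smul _ _).trans (hv.const_smul c), ?_, ?_⟩
    · intro s hs
      obtain ⟨l, hl⟩ := hva s hs
      exact ⟨c • l, fun x hx => by simp [hl hx]⟩
    · intro x hx
      simp [hv0 x hx]

/-- `G = P_h g`, the `L²` projection: `G ∈ X_h` and `(G, v) = (g, v)` for all `v ∈ X_h`. -/
def IsL2Projection {d : ℕ} {Ω : Set (Eucl d)} (X : Submodule ℝ (L2 Ω × L2Vec Ω))
    (g : L2 Ω) (G : L2 Ω × L2Vec Ω) : Prop :=
  G ∈ X ∧ ∀ V ∈ X, inner ℝ G.1 V.1 = inner ℝ g V.1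

/-- `R = R_h U`, the Ritz projection: `R ∈ X_h` and `(∇R, ∇v) = (∇U, ∇v)` for all `v ∈ X_h`. -/
def IsRitzProjection {d : ℕ} {Ω : Set (Eucl d)} (X : Submodule ℝ (L2 Ω × L2Vec Ω))
    (U R : L2 Ω × L2Vec Ω) : Prop :=
  R ∈ X ∧ ∀ V ∈ X, inner ℝ R.2 V.2 = inner ℝ U.2 V.2

/-- The graded mesh `t_n = T (n/N)^δ`. -/
def node (T δ : ℝ) (N n : ℕ) : ℝ := T * ((n : ℝ) / (N : ℝ)) ^ δ

/-- The time step `τ_n = t_n - t_{n-1}`, for `n ≥ 1`. -/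
def step (T δ : ℝ) (N n : ℕ) : ℝ := node T δ N n - node T δ N (n - 1)

/-- The discrete kernels `k_{n,j}`, for `1 ≤ j ≤ n`. -/
def kernel (α T δ : ℝ) (N n j : ℕ) : ℝ :=
  (step T δ N j)⁻¹ / Real.Gamma (1 - α) *
    ∫ s in (node T δ N (j - 1))..(node T δ N j), (node T δ N n - s) ^ (-α)

/-- The L1 approximation `𝔻^α_t u^n = ∑_{j=1}^n k_{n,j} (u^j - u^{j-1})` of the Caputo derivative
at `t_n`. -/
def discreteCaputo {d : ℕ} {Ω : Set (Eucl d)} (α T δ : ℝ) (N : ℕ)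
    (u : ℕ → L2 Ω × L2Vec Ω) (n : ℕ) : L2 Ω :=
  ∑ j ∈ Finset.Icc 1 n, kernel α T δ N n j • ((u j).1 - (u (j - 1)).1)

/-- The linearization `ũ^{n-1} = (1 + τ_n/τ_{n-1}) u^{n-1} - (τ_n/τ_{n-1}) u^{n-2}`, for `n ≥ 2`;
the argument is `n`. -/
def extrapolation {d : ℕ} {Ω : Set (Eucl d)} (T δ : ℝ) (N : ℕ)
    (u : ℕ → L2 Ω × L2Vec Ω) (n : ℕ) : L2 Ω × L2Vec Ω :=
  (1 + step T δ N n / step T δ N (n - 1)) • u (n - 1)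
    - (step T δ N n / step T δ N (n - 1)) • u (n - 2)

/-- The quadrature values `B̄(t_n, t_j, u^j, v)`, for `n ≥ 2` and `1 ≤ j ≤ n - 1`. -/
def quadForm {d : ℕ} {Ω : Set (Eucl d)} (b : MemoryCoeffs d) (T δ : ℝ) (N : ℕ)
    (u : ℕ → L2 Ω × L2Vec Ω) (n j : ℕ) (V : L2 Ω × L2Vec Ω) : ℝ :=
  if j + 2 ≤ n then
    (1 / 2 : ℝ) * (b.form (node T δ N n) (node T δ N j) (u j) V
      + b.form (node T δ N n) (node T δ N (j + 1)) (u (j + 1)) V)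
  else b.form (node T δ N n) (node T δ N (n - 1)) (u (n - 1)) V

/-- `u^0, …, u^N` solves the linearized fully discrete L1 Galerkin scheme in the space `X` with
diffusion `M`, memory coefficients `b`, source `f` and initial datum `u0`; here `fh n = f_h^n` is
the `L²` projection of `f^n = f(t_n)`. Membership in `X ⊆ H¹₀(Ω)` contains the boundary
condition. -/
structure IsDiscreteSolution {d : ℕ} {Ω : Set (Eucl d)} (α T δ : ℝ) (N : ℕ) (M : ℝ → ℝ)
    (b : MemoryCoeffs d) (f : ℝ → L2 Ω) (u0 : L2 Ω × L2Vec Ω)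
    (X : Submodule ℝ (L2 Ω × L2Vec Ω)) (fh u : ℕ → L2 Ω × L2Vec Ω) : Prop where
  source : ∀ n, 1 ≤ n → n ≤ N → IsL2Projection X (f (node T δ N n)) (fh n)
  initial : IsRitzProjection X u0 (u 0)
  mem : ∀ n, 1 ≤ n → n ≤ N → u n ∈ X
  first : ∀ V ∈ X,
    inner ℝ (discreteCaputo α T δ N u 1) V.1 + M (‖(u 1).2‖ ^ 2) * inner ℝ (u 1).2 V.2
      = inner ℝ (fh 1).1 V.1
        + step T δ N 1 * b.form (node T δ N 1) (node T δ N 1) (u 1) V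
  later : ∀ n, 2 ≤ n → n ≤ N → ∀ V ∈ X,
    inner ℝ (discreteCaputo α T δ N u n) V.1
        + M (‖(extrapolation T δ N u n).2‖ ^ 2) * inner ℝ (u n).2 V.2
      = inner ℝ (fh n).1 V.1
        + ∑ j ∈ Finset.Icc 1 (n - 1), step T δ N (j + 1) * quadForm b T δ N u n j V

/-- The weighted `H¹` norm `|||v|||_n = ‖v‖ + τ_n^{α/2} ‖∇v‖`, for `n ≥ 1`. -/
def weightedNorm {d : ℕ} {Ω : Set (Eucl d)} (α T δ : ℝ) (N n : ℕ) (V : L2 Ω × L2Vec Ω) : ℝ :=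
  ‖V.1‖ + step T δ N n ^ (α / 2) * ‖V.2‖

end KirchhoffL1

end

/-!
# Stability of a linearized L1 Galerkin scheme for a Kirchhoff equation with memory

Write `V_n = ‖u^n‖²`, `a_n = ‖∇u^n‖²`, `F = max ‖f^n‖`, and `𝔻` for the L1 quotient. Testing the
scheme with `u^n`, using `2 (𝔻u^n, u^n) ≥ 𝔻V_n`, `M ≥ m0`, the Poincaré inequality and
Cauchy–Schwarz for the memory sum gives the energy inequality
(`IsDiscreteSolution.energy_inequality`)

  `𝔻V_n + m0 a_n ≤ c F² + c₁ ∑_{j<n} τ_j a_j`.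

The memory form enters through gradients, so it has to be absorbed by the dissipation `m0 a_n`,
integrated in time. Multiplying by `τ_n` and summing, the sum `∑ τ_n 𝔻V_n` must be bounded below.
After an exchange of summation it is `∑ Q_i (V_i - V_{i-1})`, where the column sums
`Q_i = ∑_{j≥i} τ_j k_{j,i}` would be nonincreasing in `i` on a uniform mesh. On a mesh with
nondecreasing steps one has the one-sided bound `Q_{i+1} - Q_i ≤ (τ_{i+1} - τ_i) k_{i,i}`
(`columnSum_succ_le`). To see it, write `x^{-α}` as a superposition of exponentials `e^{-λx}`
(`laplace_rpow_sub`); for one exponential, `Q_i` satisfies a two-term recursion from which the bound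
follows by convexity of `exp` (`modeSum_mul_cellMean_succ_le`). The right side is of order
`(τ_{i+1} - τ_i) τ_i^{-α}` and telescopes to `τ_m^{1-α}`, whence
`-∑_{n≤m} τ_n 𝔻V_n ≤ C max_{n≤m} V_n` (`neg_sum_step_mul_caputo_le`).

A discrete Gronwall inequality then bounds `∑_{j≤m} τ_j a_j` by `C (F² + max_{n≤m} V_n)`
(`sum_step_mul_le`), and the energy inequality becomes `𝔻V_n ≤ C (F² + max_{i<n} V_i)`. This is
closed by comparison with `V_0 + K e^{μ t_n}`: for large `μ` the L1 quotient of the comparison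
sequence dominates any prescribed multiple of its previous value, whatever the step sizes
(`mul_exp_le_caputo_comparison`). The bound for `τ_n^α a_n` follows from the energy inequality,
since `k_{n,n}` is a multiple of `τ_n^{-α}` (`energy_stability`).
-/

noncomputable section

namespace KirchhoffL1

/-! ### L1 kernels on a mesh with nondecreasing steps -/

/-- A mesh `0 = t 0 < t 1 < …` whose steps are nondecreasing and grow by a factor of at most `ρ`
from one cell to the next. -/
structure IsConvexMesh (t : ℕ → ℝ) (ρ : ℝ) : Prop where
  zero : t 0 = 0
  lt_succ : ∀ n, t n < t (n + 1)
  step_mono : ∀ n, t (n + 1) - t n ≤ t (n + 2) - t (n + 1)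
  step_ratio : ∀ n, t (n + 2) - t (n + 1) ≤ ρ * (t (n + 1) - t n)

/-- The L1 kernel attached to the evaluation point `t n` and the cell `[t i, t (i + 1)]`, in closed
form. Cells are numbered from `0`, so this is `k_{n,i+1}`. -/
def l1Kernel (α : ℝ) (t : ℕ → ℝ) (n i : ℕ) : ℝ :=
  (Real.Gamma (2 - α))⁻¹ *
    (((t n - t i) ^ (1 - α) - (t n - t (i + 1)) ^ (1 - α)) / (t (i + 1) - t i))

/-- The L1 difference quotient of a real sequence. -/
def caputo (α : ℝ) (t : ℕ → ℝ) (V : ℕ → ℝ) (n : ℕ) : ℝ :=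
  ∑ i ∈ Finset.range n, l1Kernel α t n i * (V (i + 1) - V i)

lemma IsConvexMesh.strictMono {t : ℕ → ℝ} {ρ : ℝ} (ht : IsConvexMesh t ρ) : StrictMono t :=
  strictMono_nat_of_lt_succ ht.lt_succ

lemma IsConvexMesh.nonneg {t : ℕ → ℝ} {ρ : ℝ} (ht : IsConvexMesh t ρ) (n : ℕ) : 0 ≤ t n := by
  rw [← ht.zero]; exact ht.strictMono.monotone (Nat.zero_le n)

lemma IsConvexMesh.step_pos {t : ℕ → ℝ} {ρ : ℝ} (ht : IsConvexMesh t ρ) (n : ℕ) :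
    0 < t (n + 1) - t n :=
  sub_pos.2 (ht.lt_succ n)

lemma IsConvexMesh.ratio_pos {t : ℕ → ℝ} {ρ : ℝ} (ht : IsConvexMesh t ρ) : 0 < ρ :=
  pos_of_mul_pos_left ((ht.step_pos 1).trans_le (ht.step_ratio 0)) (ht.step_pos 0).le

lemma mul_rpow_neg_mul_sub_le {α a b : ℝ} (hα0 : 0 < α) (hα1 : α < 1) (ha : 0 ≤ a) (hb : 0 < b) :
    (1 - α) * (b ^ (-α) * (b - a)) ≤ b ^ (1 - α) - a ^ (1 - α) := by
  have h := rpow_one_add_le_one_add_mul_self (s := a / b - 1) (p := 1 - α)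
    (by linarith [div_nonneg ha hb.le]) (by linarith) (by linarith)
  have h1 : (1 + (a / b - 1)) = a / b := by ring
  rw [h1, Real.div_rpow ha hb.le, div_le_iff₀ (Real.rpow_pos_of_pos hb _)] at h
  have h2 : b ^ (1 - α) = b ^ (-α) * b := by
    rw [show 1 - α = -α + 1 by ring, Real.rpow_add hb, Real.rpow_one]
  rw [h2] at h ⊢
  have h3 : (1 + (1 - α) * (a / b - 1)) * (b ^ (-α) * b)
      = b ^ (-α) * b - (1 - α) * (b ^ (-α) * (b - a)) := by
    field_simp; ring
  linarith

lemma gamma_two_sub {α : ℝ} (hα1 : α < 1) :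
    Real.Gamma (2 - α) = (1 - α) * Real.Gamma (1 - α) := by
  rw [← Real.Gamma_add_one (by linarith)]; ring_nf

lemma gamma_two_sub_pos {α : ℝ} (hα1 : α < 1) : 0 < Real.Gamma (2 - α) :=
  Real.Gamma_pos_of_pos (by linarith)

section Kernel

variable {α ρ : ℝ} {t : ℕ → ℝ}

lemma rpow_neg_le_l1Kernel (hα0 : 0 < α) (hα1 : α < 1) (ht : IsConvexMesh t ρ) {n i : ℕ}
    (hi : i < n) :
    (Real.Gamma (1 - α))⁻¹ * (t n - t i) ^ (-α) ≤ l1Kernel α t n i := by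
  have h1 : t (i + 1) ≤ t n := ht.strictMono.monotone hi
  have h0 := ht.lt_succ i
  have hG : 0 < Real.Gamma (1 - α) := Real.Gamma_pos_of_pos (by linarith)
  have := mul_rpow_neg_mul_sub_le hα0 hα1 (a := t n - t (i + 1)) (b := t n - t i)
    (by linarith) (by linarith)
  rw [l1Kernel, gamma_two_sub hα1, mul_inv_rev, mul_assoc]
  gcongr
  rw [inv_mul_eq_div, le_div_iff₀ (by linarith), le_div_iff₀ (by linarith)]
  calc _ = (1 - α) * ((t n - t i) ^ (-α) * (t n - t i - (t n - t (i + 1)))) := by ring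
    _ ≤ _ := this

lemma l1Kernel_pos (hα0 : 0 < α) (hα1 : α < 1) (ht : IsConvexMesh t ρ) {n i : ℕ}
    (hi : i < n) : 0 < l1Kernel α t n i := by
  refine lt_of_lt_of_le ?_ (rpow_neg_le_l1Kernel hα0 hα1 ht hi)
  have hG : 0 < Real.Gamma (1 - α) := Real.Gamma_pos_of_pos (by linarith)
  have := ht.strictMono hi
  have : 0 < t n - t i := by linarith
  positivity

lemma l1Kernel_le_succ (hα0 : 0 < α) (hα1 : α < 1) (ht : IsConvexMesh t ρ) {n i : ℕ}
    (hi : i + 1 < n) : l1Kernel α t n i ≤ l1Kernel α t n (i + 1) := by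
  have h2 : t (i + 2) ≤ t n := ht.strictMono.monotone hi
  have h0 := ht.lt_succ i
  have h1 := ht.lt_succ (i + 1)
  have := gamma_two_sub_pos hα1
  have hs := (Real.concaveOn_rpow (p := 1 - α) (by linarith) (by linarith)).slope_anti_adjacent
    (x := t n - t (i + 2)) (y := t n - t (i + 1)) (z := t n - t i)
    (by simpa using h2) (mem_Ici.2 (by linarith)) (by linarith) (by linarith)
  rw [l1Kernel, l1Kernel]
  gcongr ?_ * ?_
  convert hs using 2 <;> ring

lemma l1Kernel_self (hα1 : α < 1) (ht : IsConvexMesh t ρ) (n : ℕ) :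
    l1Kernel α t (n + 1) n = (Real.Gamma (2 - α))⁻¹ * (t (n + 1) - t n) ^ (-α) := by
  have h : 0 < t (n + 1) - t n := sub_pos.2 (ht.lt_succ n)
  rw [l1Kernel, sub_self, Real.zero_rpow (by linarith), sub_zero,
    show -α = (1 - α) - 1 by ring, Real.rpow_sub_one h.ne']

/-- The discrete maximum principle, in quantitative form. -/
lemma caputo_succ_le (hα0 : 0 < α) (hα1 : α < 1) (ht : IsConvexMesh t ρ) {W : ℕ → ℝ} {n : ℕ}
    (hW : ∀ j ≤ n, 0 ≤ W j) :
    caputo α t W (n + 1) ≤ l1Kernel α t (n + 1) n * W (n + 1) := by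
  have key : ∀ m ≤ n, ∑ i ∈ Finset.range (m + 1),
      l1Kernel α t (n + 1) i * (W (i + 1) - W i) ≤ l1Kernel α t (n + 1) m * W (m + 1) := by
    intro m
    induction m with
    | zero =>
      intro _
      have := mul_nonneg (l1Kernel_pos hα0 hα1 ht (Nat.succ_pos n)).le (hW 0 (Nat.zero_le _))
      simp only [zero_add, Finset.sum_range_one]
      linarith
    | succ m ih =>
      intro hm
      rw [Finset.sum_range_succ]
      have h1 := ih (by omega)
      have h2 := mul_le_mul_of_nonneg_right
        (l1Kernel_le_succ hα0 hα1 ht (n := n + 1) (i := m) (by omega)) (hW (m + 1) hm)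
      linarith
  exact key n le_rfl

lemma caputo_sub (V W : ℕ → ℝ) (n : ℕ) :
    caputo α t (fun j => V j - W j) n = caputo α t V n - caputo α t W n := by
  simp only [caputo, ← Finset.sum_sub_distrib]
  exact Finset.sum_congr rfl fun i _ => by ring

lemma caputo_const_add_mul (c K : ℝ) (V : ℕ → ℝ) (n : ℕ) :
    caputo α t (fun j => c + K * V j) n = K * caputo α t V n := by
  simp only [caputo, Finset.mul_sum]
  exact Finset.sum_congr rfl fun i _ => by ring

/-- Twice `(𝔻u^n, u^n)` exceeds `𝔻‖u^n‖²` by minus the L1 quotient of `‖u^j - u^n‖²`, which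
is nonnegative because the last of these terms vanishes. -/
lemma caputo_norm_sq_le {H : Type*} [NormedAddCommGroup H] [InnerProductSpace ℝ H]
    (hα0 : 0 < α) (hα1 : α < 1) (ht : IsConvexMesh t ρ) (u : ℕ → H) (n : ℕ) :
    caputo α t (fun j => ‖u j‖ ^ 2) (n + 1) ≤
      2 * inner ℝ (∑ i ∈ Finset.range (n + 1), l1Kernel α t (n + 1) i • (u (i + 1) - u i))
        (u (n + 1)) := by
  have h := caputo_succ_le hα0 hα1 ht (W := fun j => ‖u j - u (n + 1)‖ ^ 2) (n := n)
    (fun j _ => by positivity)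
  simp only [sub_self, norm_zero, ne_eq, OfNat.ofNat_ne_zero, not_false_eq_true, zero_pow,
    mul_zero] at h
  have h2 : caputo α t (fun j => ‖u j - u (n + 1)‖ ^ 2) (n + 1)
      = caputo α t (fun j => ‖u j‖ ^ 2) (n + 1) -
      2 * inner ℝ (∑ i ∈ Finset.range (n + 1), l1Kernel α t (n + 1) i • (u (i + 1) - u i))
        (u (n + 1)) := by
    simp only [caputo, sum_inner, Finset.mul_sum, ← Finset.sum_sub_distrib, norm_sub_sq_real,
      inner_smul_left, inner_sub_left, RCLike.conj_to_real]
    exact Finset.sum_congr rfl fun i _ => by ring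
  linarith

end Kernel

/-! ### Laplace representation of the kernels -/

lemma integral_exp_neg_mul_Ioc {l a b : ℝ} (hl : 0 < l) (hab : a ≤ b) :
    ∫ x in Ioc a b, Real.exp (-(l * x)) = (Real.exp (-(l * a)) - Real.exp (-(l * b))) / l := by
  rw [← intervalIntegral.integral_of_le hab]
  have h : ∀ x ∈ uIcc a b,
      HasDerivAt (fun x => -(Real.exp (-(l * x)) / l)) (Real.exp (-(l * x))) x := by
    intro x _
    have h1 : HasDerivAt (fun x : ℝ => -(l * x)) (-(l * 1)) x :=
      ((hasDerivAt_id x).const_mul l).neg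
    refine (h1.exp.div_const l).neg.congr_deriv ?_
    rw [mul_one, mul_neg, neg_div, neg_neg, mul_div_cancel_right₀ _ hl.ne']
  rw [intervalIntegral.integral_eq_sub_of_hasDerivAt h
    ((by fun_prop : Continuous fun x : ℝ => Real.exp (-(l * x))).intervalIntegrable _ _)]
  ring

/-- The power `x ^ (1 - α)` as a superposition of decaying exponentials: its increments are
`∫ λ^(α-2) (e^(-λa) - e^(-λb)) dλ` up to a constant. -/
lemma laplace_rpow_sub {α a b : ℝ} (hα0 : 0 < α) (hα1 : α < 1) (ha : 0 ≤ a) (hab : a ≤ b) :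
    IntegrableOn (fun l : ℝ => l ^ (α - 2) * (Real.exp (-(l * a)) - Real.exp (-(l * b)))) (Ioi 0) ∧
    ∫ l in Ioi (0 : ℝ), l ^ (α - 2) * (Real.exp (-(l * a)) - Real.exp (-(l * b)))
      = Real.Gamma α / (1 - α) * (b ^ (1 - α) - a ^ (1 - α)) := by
  have hcell : ∀ l ∈ Ioi (0 : ℝ), ∫ x in Ioc a b, l ^ (α - 1) * Real.exp (-(l * x))
      = l ^ (α - 2) * (Real.exp (-(l * a)) - Real.exp (-(l * b))) := by
    intro l hl
    rw [integral_const_mul, integral_exp_neg_mul_Ioc hl hab,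
      show α - 2 = (α - 1) - 1 by ring, Real.rpow_sub_one (ne_of_gt hl) (α - 1)]
    ring
  have hpow : ∀ x ∈ Ioc a b, ∫ l in Ioi (0 : ℝ), l ^ (α - 1) * Real.exp (-(l * x))
      = Real.Gamma α * x ^ (-α) := by
    intro x hx
    have hx0 : 0 < x := lt_of_le_of_lt ha hx.1
    have := Real.integral_rpow_mul_exp_neg_mul_Ioi hα0 hx0
    simp only [mul_comm x] at this
    rw [this, one_div, Real.inv_rpow hx0.le, Real.rpow_neg hx0.le, mul_comm]
  have hint : ∀ x ∈ Ioc a b,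
      IntegrableOn (fun l : ℝ => l ^ (α - 1) * Real.exp (-(l * x))) (Ioi 0) := by
    intro x hx
    have hx0 : 0 < x := lt_of_le_of_lt ha hx.1
    have := integrableOn_rpow_mul_exp_neg_mul_rpow (p := 1) (s := α - 1) (b := x)
      (by linarith) one_pos hx0
    refine this.congr_fun (fun l _ => ?_) measurableSet_Ioi
    simp only [Real.rpow_one]
    ring_nf
  have hmeas : AEStronglyMeasurable
      (Function.uncurry fun (l x : ℝ) => l ^ (α - 1) * Real.exp (-(l * x)))
      ((volume.restrict (Ioi 0)).prod (volume.restrict (Ioc a b))) := by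
    refine Measurable.aestronglyMeasurable ?_
    simp only [Function.uncurry_def]
    fun_prop
  have hprod : Integrable (Function.uncurry fun (l x : ℝ) => l ^ (α - 1) * Real.exp (-(l * x)))
      ((volume.restrict (Ioi 0)).prod (volume.restrict (Ioc a b))) := by
    rw [integrable_prod_iff' hmeas]
    refine ⟨?_, ?_⟩
    · filter_upwards [ae_restrict_mem measurableSet_Ioc] with x hx using hint x hx
    · have h1 : IntegrableOn (fun x : ℝ => Real.Gamma α * x ^ (-α)) (Ioc a b) := by
        rw [← intervalIntegrable_iff_integrableOn_Ioc_of_le hab]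
        exact (intervalIntegral.intervalIntegrable_rpow' (by linarith)).const_mul _
      refine h1.congr_fun (fun x hx => ?_) measurableSet_Ioc
      refine (hpow x hx).symm.trans ?_
      refine setIntegral_congr_fun measurableSet_Ioi fun l hl => ?_
      have : 0 < l := hl
      exact (Real.norm_of_nonneg (by positivity)).symm
  refine ⟨?_, ?_⟩
  · exact IntegrableOn.congr_fun (f := fun l => ∫ x in Ioc a b, l ^ (α - 1) * Real.exp (-(l * x)))
      hprod.integral_prod_left hcell measurableSet_Ioi
  · rw [← setIntegral_congr_fun measurableSet_Ioi hcell, integral_integral_swap hprod,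
      setIntegral_congr_fun measurableSet_Ioc hpow, integral_const_mul,
      ← intervalIntegral.integral_of_le hab, integral_rpow (Or.inl (by linarith))]
    rw [show -α + 1 = 1 - α by ring]
    ring

lemma exp_sub_one_div_mono {l x y : ℝ} (hl : 0 < l) (hx : 0 < x) (hxy : x ≤ y) :
    (Real.exp (l * x) - 1) / x ≤ (Real.exp (l * y) - 1) / y := by
  have hy : 0 < y := hx.trans_le hxy
  have h := convexOn_exp.secant_mono (a := 0) (x := l * x) (y := l * y) trivial trivial
    trivial (by positivity) (by positivity) (by gcongr)
  rw [Real.exp_zero, sub_zero, sub_zero, div_le_div_iff₀ (by positivity) (by positivity)] at h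
  rw [div_le_div_iff₀ hx hy]
  refine le_of_mul_le_mul_left ?_ hl
  linarith

lemma one_sub_exp_neg_div_anti {l x y : ℝ} (hl : 0 < l) (hx : 0 < x) (hxy : x ≤ y) :
    (1 - Real.exp (-(l * y))) / y ≤ (1 - Real.exp (-(l * x))) / x := by
  have hy : 0 < y := hx.trans_le hxy
  have h := convexOn_exp.secant_mono (a := 0) (x := -(l * y)) (y := -(l * x)) trivial trivial
    trivial (neg_ne_zero.2 (by positivity)) (neg_ne_zero.2 (by positivity)) (by gcongr)
  rw [Real.exp_zero, sub_zero, sub_zero, div_neg, div_neg, neg_le_neg_iff,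
    div_le_div_iff₀ (by positivity) (by positivity)] at h
  rw [div_le_div_iff₀ hy hx]
  refine le_of_mul_le_mul_left ?_ hl
  linarith

section Column

variable {α ρ : ℝ} {t : ℕ → ℝ}

/-- The discrete integral `∑_{n ≥ i} τ_n e^{-l (t_{n+1} - t_{i+1})}` of one exponential mode. -/
def modeSum (t : ℕ → ℝ) (m : ℕ) (l : ℝ) (i : ℕ) : ℝ :=
  ∑ n ∈ Finset.Ico i m, (t (n + 1) - t n) * Real.exp (-(l * (t (n + 1) - t (i + 1))))

/-- The mean of `l e^{-l (t_{i+1} - s)}` over the cell `[t i, t (i + 1)]`. -/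
def cellMean (t : ℕ → ℝ) (l : ℝ) (i : ℕ) : ℝ :=
  (1 - Real.exp (-(l * (t (i + 1) - t i)))) / (t (i + 1) - t i)

lemma cellMean_pos (ht : IsConvexMesh t ρ) {l : ℝ} (hl : 0 < l) (i : ℕ) : 0 < cellMean t l i := by
  have h : 0 < t (i + 1) - t i := sub_pos.2 (ht.lt_succ i)
  have : Real.exp (-(l * (t (i + 1) - t i))) < 1 := by
    rw [Real.exp_lt_one_iff]
    have := mul_pos hl h
    linarith
  exact div_pos (by linarith) h

lemma modeSum_eq {m i : ℕ} (hi : i < m) (t : ℕ → ℝ) (l : ℝ) :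
    modeSum t m l i = (t (i + 1) - t i) +
      Real.exp (-(l * (t (i + 2) - t (i + 1)))) * modeSum t m l (i + 1) := by
  rw [modeSum, Finset.sum_eq_sum_Ico_succ_bot hi, modeSum, Finset.mul_sum]
  congr 1
  · simp
  · refine Finset.sum_congr rfl fun n _ => ?_
    rw [mul_left_comm, ← Real.exp_add]
    congr 2
    ring

lemma modeSum_nonneg (ht : IsConvexMesh t ρ) (m i : ℕ) (l : ℝ) : 0 ≤ modeSum t m l i :=
  Finset.sum_nonneg fun n _ => mul_nonneg (sub_pos.2 (ht.lt_succ n)).le (Real.exp_pos _).le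

lemma modeSum_mul_cellMean_le_one (ht : IsConvexMesh t ρ) {l : ℝ} (hl : 0 < l) (m i : ℕ) :
    modeSum t m l i * cellMean t l i ≤ 1 := by
  by_cases hi : m ≤ i
  · simp [modeSum, Finset.Ico_eq_empty_of_le hi]
  · have hi' : i < m := not_le.1 hi
    have ih := modeSum_mul_cellMean_le_one ht hl m (i + 1)
    rw [modeSum_eq hi']
    have hτ : 0 < t (i + 1) - t i := sub_pos.2 (ht.lt_succ i)
    have hτ' : 0 < t (i + 2) - t (i + 1) := sub_pos.2 (ht.lt_succ (i + 1))
    have hP := cellMean_pos ht hl i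
    have hP' := cellMean_pos ht hl (i + 1)
    have hexp := exp_sub_one_div_mono hl hτ (ht.step_mono i)
    -- `e₁ ψ₀ ≤ e₀ ψ₁`: the function `x / (e^x - 1)` is nonincreasing
    have hcross : Real.exp (-(l * (t (i + 2) - t (i + 1)))) * cellMean t l i
        ≤ Real.exp (-(l * (t (i + 1) - t i))) * cellMean t l (i + 1) := by
      have h0 : cellMean t l i = Real.exp (-(l * (t (i + 1) - t i))) *
          ((Real.exp (l * (t (i + 1) - t i)) - 1) / (t (i + 1) - t i)) := by
        rw [cellMean, ← mul_div_assoc, mul_sub (Real.exp _), ← Real.exp_add]; simp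
      have h1 : cellMean t l (i + 1) = Real.exp (-(l * (t (i + 2) - t (i + 1)))) *
          ((Real.exp (l * (t (i + 2) - t (i + 1))) - 1) / (t (i + 2) - t (i + 1))) := by
        rw [cellMean, ← mul_div_assoc, mul_sub (Real.exp _), ← Real.exp_add]; simp
      rw [h0, h1, mul_left_comm]
      gcongr
    have hself : (t (i + 1) - t i) * cellMean t l i
        = 1 - Real.exp (-(l * (t (i + 1) - t i))) := by
      rw [cellMean, mul_div_cancel₀ _ hτ.ne']
    have hF := modeSum_nonneg ht m (i + 1) l
    calc _ = (t (i + 1) - t i) * cellMean t l i + modeSum t m l (i + 1) *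
          (Real.exp (-(l * (t (i + 2) - t (i + 1)))) * cellMean t l i) := by ring
      _ ≤ (t (i + 1) - t i) * cellMean t l i + modeSum t m l (i + 1) *
          (Real.exp (-(l * (t (i + 1) - t i))) * cellMean t l (i + 1)) := by gcongr
      _ = 1 - Real.exp (-(l * (t (i + 1) - t i))) + Real.exp (-(l * (t (i + 1) - t i))) *
          (modeSum t m l (i + 1) * cellMean t l (i + 1)) := by rw [hself]; ring
      _ ≤ 1 - Real.exp (-(l * (t (i + 1) - t i))) + Real.exp (-(l * (t (i + 1) - t i))) * 1 := by
        gcongr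
      _ = 1 := by ring
termination_by m - i

/-- On a uniform mesh `modeSum t m l i * cellMean t l i` is nonincreasing in `i`; the last term
accounts for the growth of the step. -/
lemma modeSum_mul_cellMean_succ_le (ht : IsConvexMesh t ρ) {l : ℝ} (hl : 0 < l) {m i : ℕ}
    (hi : i < m) :
    modeSum t m l (i + 1) * cellMean t l (i + 1) ≤ modeSum t m l i * cellMean t l i +
      ((t (i + 2) - t (i + 1)) - (t (i + 1) - t i)) * cellMean t l i := by
  have h1 := modeSum_mul_cellMean_le_one ht hl m (i + 1)
  have hτ : 0 < t (i + 1) - t i := sub_pos.2 (ht.lt_succ i)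
  have hτ' : 0 < t (i + 2) - t (i + 1) := sub_pos.2 (ht.lt_succ (i + 1))
  have hanti : cellMean t l (i + 1) ≤ cellMean t l i :=
    one_sub_exp_neg_div_anti hl hτ (ht.step_mono i)
  have hE : Real.exp (-(l * (t (i + 2) - t (i + 1))))
      = 1 - (t (i + 2) - t (i + 1)) * cellMean t l (i + 1) := by
    rw [cellMean, mul_div_cancel₀ _ hτ'.ne']; ring
  rw [modeSum_eq hi, hE]
  have h2 := mul_le_mul_of_nonneg_left hanti (modeSum_nonneg ht m (i + 1) l)
  have h3 := mul_le_mul_of_nonneg_left h1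
    (mul_nonneg (cellMean_pos ht hl i).le hτ'.le)
  nlinarith

lemma exp_sub_exp_eq_mul_cellMean (ht : IsConvexMesh t ρ) (l : ℝ) (n i : ℕ) :
    Real.exp (-(l * (t n - t (i + 1)))) - Real.exp (-(l * (t n - t i)))
      = (t (i + 1) - t i) * (Real.exp (-(l * (t n - t (i + 1)))) * cellMean t l i) := by
  have hτ : 0 < t (i + 1) - t i := sub_pos.2 (ht.lt_succ i)
  rw [cellMean, mul_left_comm, mul_div_cancel₀ _ hτ.ne', mul_sub (Real.exp _),
    ← Real.exp_add, mul_one]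
  congr 2
  ring

/-- The constant in the Laplace representation of the kernels. -/
def laplaceConst (α : ℝ) : ℝ := (Real.Gamma (2 - α))⁻¹ * ((1 - α) / Real.Gamma α)

lemma l1Kernel_eq_integral (hα0 : 0 < α) (hα1 : α < 1) (ht : IsConvexMesh t ρ) {n i : ℕ}
    (hi : i < n) :
    IntegrableOn (fun l : ℝ => l ^ (α - 2) *
      (Real.exp (-(l * (t n - t (i + 1)))) * cellMean t l i)) (Ioi 0) ∧
    l1Kernel α t n i = laplaceConst α * ∫ l in Ioi (0 : ℝ), l ^ (α - 2) *
      (Real.exp (-(l * (t n - t (i + 1)))) * cellMean t l i) := by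
  have hτ : 0 < t (i + 1) - t i := sub_pos.2 (ht.lt_succ i)
  have h1 : t (i + 1) ≤ t n := ht.strictMono.monotone hi
  have hG : 0 < Real.Gamma α := Real.Gamma_pos_of_pos hα0
  obtain ⟨hint, hval⟩ := laplace_rpow_sub hα0 hα1 (a := t n - t (i + 1)) (b := t n - t i)
    (by linarith) (by linarith)
  have hfun : ∀ l : ℝ, l ^ (α - 2) * (Real.exp (-(l * (t n - t (i + 1)))) * cellMean t l i)
      = (t (i + 1) - t i)⁻¹ * (l ^ (α - 2) *
        (Real.exp (-(l * (t n - t (i + 1)))) - Real.exp (-(l * (t n - t i))))) := by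
    intro l
    rw [exp_sub_exp_eq_mul_cellMean ht]
    field_simp
  simp only [hfun]
  refine ⟨hint.const_mul _, ?_⟩
  rw [integral_const_mul, hval, l1Kernel, laplaceConst]
  have : (1 - α) ≠ 0 := by linarith
  field_simp

/-- The `i`-th column sum `∑_{i ≤ n < m} τ_{n+1} k_{n+1,i+1}` of the kernels, weighted by the
steps. -/
def columnSum (α : ℝ) (t : ℕ → ℝ) (m i : ℕ) : ℝ :=
  ∑ n ∈ Finset.Ico i m, (t (n + 1) - t n) * l1Kernel α t (n + 1) i

lemma columnSum_nonneg (hα0 : 0 < α) (hα1 : α < 1) (ht : IsConvexMesh t ρ) (m i : ℕ) :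
    0 ≤ columnSum α t m i :=
  Finset.sum_nonneg fun n hn => mul_nonneg (sub_pos.2 (ht.lt_succ n)).le
    (l1Kernel_pos hα0 hα1 ht (by have := (Finset.mem_Ico.1 hn).1; omega)).le

lemma columnSum_eq_integral (hα0 : 0 < α) (hα1 : α < 1) (ht : IsConvexMesh t ρ) (m i : ℕ) :
    IntegrableOn (fun l : ℝ => l ^ (α - 2) * (modeSum t m l i * cellMean t l i)) (Ioi 0) ∧
    columnSum α t m i = laplaceConst α * ∫ l in Ioi (0 : ℝ), l ^ (α - 2) *
      (modeSum t m l i * cellMean t l i) := by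
  have hfun : ∀ l : ℝ, l ^ (α - 2) * (modeSum t m l i * cellMean t l i)
      = ∑ n ∈ Finset.Ico i m, (t (n + 1) - t n) * (l ^ (α - 2) *
        (Real.exp (-(l * (t (n + 1) - t (i + 1)))) * cellMean t l i)) := by
    intro l
    rw [modeSum, Finset.sum_mul, Finset.mul_sum]
    exact Finset.sum_congr rfl fun n _ => by ring
  have hterm : ∀ n ∈ Finset.Ico i m, IntegrableOn (fun l : ℝ => (t (n + 1) - t n) *
      (l ^ (α - 2) * (Real.exp (-(l * (t (n + 1) - t (i + 1)))) * cellMean t l i))) (Ioi 0) :=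
    fun n hn => (l1Kernel_eq_integral hα0 hα1 ht
      (by have := (Finset.mem_Ico.1 hn).1; omega)).1.const_mul _
  simp only [hfun]
  refine ⟨integrable_finsetSum _ hterm, ?_⟩
  rw [integral_finsetSum _ hterm, columnSum, Finset.mul_sum]
  refine Finset.sum_congr rfl fun n hn => ?_
  rw [integral_const_mul, (l1Kernel_eq_integral hα0 hα1 ht
      (by have := (Finset.mem_Ico.1 hn).1; omega)).2]
  ring

/-- The column sums increase by no more than the growth of the steps accounts for. -/
lemma columnSum_succ_le (hα0 : 0 < α) (hα1 : α < 1) (ht : IsConvexMesh t ρ) {m i : ℕ}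
    (hi : i < m) :
    columnSum α t m (i + 1) ≤ columnSum α t m i +
      ((t (i + 2) - t (i + 1)) - (t (i + 1) - t i)) * l1Kernel α t (i + 1) i := by
  obtain ⟨hi1, hv1⟩ := columnSum_eq_integral hα0 hα1 ht m (i + 1)
  obtain ⟨hi0, hv0⟩ := columnSum_eq_integral hα0 hα1 ht m i
  obtain ⟨hik, hvk⟩ := l1Kernel_eq_integral hα0 hα1 ht (Nat.lt_succ_self i)
  simp only [Nat.succ_eq_add_one, sub_self, mul_zero, neg_zero, Real.exp_zero, one_mul] at hik hvk
  have hC : 0 ≤ laplaceConst α := by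
    have := gamma_two_sub_pos hα1
    have := Real.Gamma_pos_of_pos hα0
    have : 0 < 1 - α := by linarith
    unfold laplaceConst
    positivity
  rw [hv1, hv0, hvk, mul_left_comm, ← mul_add,
    ← integral_const_mul ((t (i + 2) - t (i + 1)) - (t (i + 1) - t i)),
    ← integral_add hi0 (hik.const_mul _)]
  refine mul_le_mul_of_nonneg_left ?_ hC
  refine setIntegral_mono_on hi1 (hi0.add (hik.const_mul _)) measurableSet_Ioi fun l hl => ?_
  have hl' : 0 < l := hl
  calc _ ≤ l ^ (α - 2) * (modeSum t m l i * cellMean t l i +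
      ((t (i + 2) - t (i + 1)) - (t (i + 1) - t i)) * cellMean t l i) :=
        mul_le_mul_of_nonneg_left (modeSum_mul_cellMean_succ_le ht hl' hi) (by positivity)
    _ = _ := by ring

end Column

/-! ### Bounded variation of the column sums -/

lemma rpow_sub_rpow_le {α a b : ℝ} (hα0 : 0 < α) (ha : 0 ≤ a) (hab : a ≤ b) (hb : 0 < b) :
    b ^ (1 - α) - a ^ (1 - α) ≤ b ^ (-α) * (b - a) := by
  have h2 : ∀ x : ℝ, 0 < x → x ^ (1 - α) = x ^ (-α) * x := fun x hx => by
    rw [show 1 - α = -α + 1 by ring, Real.rpow_add hx, Real.rpow_one]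
  rcases ha.eq_or_lt with rfl | ha'
  · have := Real.rpow_nonneg (le_refl (0 : ℝ)) (1 - α)
    rw [h2 b hb]
    linarith
  · have h3 := Real.rpow_le_rpow_of_nonpos ha' hab (z := -α) (by linarith)
    rw [h2 b hb, h2 a ha']
    nlinarith

section Variation

variable {α ρ T : ℝ} {t : ℕ → ℝ}

/-- The growth of the step times the diagonal kernel is dominated by the increment of a
nondecreasing sequence, so that its sum telescopes. -/
lemma step_sub_mul_l1Kernel_le (hα0 : 0 < α) (hα1 : α < 1) (ht : IsConvexMesh t ρ) (i : ℕ) :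
    ((t (i + 2) - t (i + 1)) - (t (i + 1) - t i)) * l1Kernel α t (i + 1) i ≤
      ρ ^ α / ((1 - α) * Real.Gamma (2 - α)) * (t (i + 2) - t (i + 1)) ^ (1 - α) -
      ρ ^ α / ((1 - α) * Real.Gamma (2 - α)) * (t (i + 1) - t i) ^ (1 - α) := by
  have hτ := ht.step_pos i
  have hτ' := ht.step_pos (i + 1)
  have hρ := ht.ratio_pos
  have hG := gamma_two_sub_pos hα1
  have h1α : 0 < 1 - α := by linarith
  have hmono := ht.step_mono i
  rw [l1Kernel_self hα1 ht, ← mul_sub]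
  have h1 := mul_rpow_neg_mul_sub_le hα0 hα1 hτ.le hτ'
  have h2 : (t (i + 1) - t i) ^ (-α) ≤ ρ ^ α * (t (i + 2) - t (i + 1)) ^ (-α) := by
    have h3 := Real.rpow_le_rpow hτ'.le (ht.step_ratio i) hα0.le
    rw [Real.mul_rpow hρ.le hτ.le] at h3
    rw [Real.rpow_neg hτ.le, Real.rpow_neg hτ'.le, ← div_eq_mul_inv, le_div_iff₀ (by positivity),
      inv_mul_eq_div, div_le_iff₀ (by positivity)]
    exact h3
  have hd : 0 ≤ (t (i + 2) - t (i + 1)) - (t (i + 1) - t i) := by linarith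
  calc _ ≤ ((t (i + 2) - t (i + 1)) - (t (i + 1) - t i)) *
        ((Real.Gamma (2 - α))⁻¹ * (ρ ^ α * (t (i + 2) - t (i + 1)) ^ (-α))) := by gcongr
    _ = ρ ^ α / ((1 - α) * Real.Gamma (2 - α)) * ((1 - α) * ((t (i + 2) - t (i + 1)) ^ (-α) *
        ((t (i + 2) - t (i + 1)) - (t (i + 1) - t i)))) := by field_simp
    _ ≤ _ := by gcongr

lemma columnSum_zero_le (hα0 : 0 < α) (hα1 : α < 1) (ht : IsConvexMesh t ρ) (m : ℕ) :
    columnSum α t m 0 ≤ 1 / ((1 - α) * Real.Gamma (2 - α)) * t m ^ (1 - α) := by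
  have hG := gamma_two_sub_pos hα1
  have h1α : 0 < 1 - α := by linarith
  have hterm : ∀ n ∈ Finset.range m, (t (n + 1) - t n) * l1Kernel α t (n + 1) 0 ≤
      1 / ((1 - α) * Real.Gamma (2 - α)) * (t (n + 1) ^ (1 - α) - t n ^ (1 - α)) := by
    intro n _
    have hn := ht.nonneg n
    have hτ := ht.step_pos n
    have hpos : 0 < t (n + 1) := by linarith
    have ht1 : 0 < t 1 := by have := ht.step_pos 0; rw [ht.zero] at this; linarith
    have ht1n : t 1 ≤ t (n + 1) := ht.strictMono.monotone (by omega)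
    have h1 := rpow_sub_rpow_le hα0 (a := t (n + 1) - t 1) (b := t (n + 1))
      (by linarith) (by linarith) hpos
    have h2 := mul_rpow_neg_mul_sub_le hα0 hα1 hn hpos
    have h3 : l1Kernel α t (n + 1) 0 ≤ (Real.Gamma (2 - α))⁻¹ * t (n + 1) ^ (-α) := by
      rw [l1Kernel, zero_add, ht.zero, sub_zero, sub_zero]
      gcongr
      rw [div_le_iff₀ ht1]
      linarith
    calc _ ≤ (t (n + 1) - t n) * ((Real.Gamma (2 - α))⁻¹ * t (n + 1) ^ (-α)) := by gcongr
      _ = 1 / ((1 - α) * Real.Gamma (2 - α)) *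
          ((1 - α) * (t (n + 1) ^ (-α) * (t (n + 1) - t n))) := by field_simp
      _ ≤ _ := by gcongr
  rw [columnSum, ← Finset.range_eq_Ico]
  refine (Finset.sum_le_sum hterm).trans ?_
  rw [← Finset.mul_sum, Finset.sum_range_sub (fun n => t n ^ (1 - α)), ht.zero,
    Real.zero_rpow h1α.ne', sub_zero]

lemma sum_step_mul_caputo (V : ℕ → ℝ) (m : ℕ) :
    ∑ n ∈ Finset.range m, (t (n + 1) - t n) * caputo α t V (n + 1) =
      ∑ i ∈ Finset.range m, columnSum α t m i * (V (i + 1) - V i) := by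
  simp only [caputo, columnSum, Finset.mul_sum, Finset.sum_mul]
  rw [Finset.sum_comm' (t' := Finset.range m) (s' := fun i => Finset.Ico i m)]
  · exact Finset.sum_congr rfl fun i _ => Finset.sum_congr rfl fun n _ => by ring
  · intro n i
    simp only [Finset.mem_range, Finset.mem_Ico]
    omega

/-- The constant in `neg_sum_step_mul_caputo_le`. -/
def variationConst (α ρ T : ℝ) : ℝ :=
  (1 + ρ ^ α) / ((1 - α) * Real.Gamma (2 - α)) * T ^ (1 - α)

/-- The time integral of the L1 quotient of a nonnegative sequence is bounded below by its maximum.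
In the continuous setting `∫ ∂^α V` is a fractional integral of `V` minus a boundary term; here the
column sums replace the constant weight, and only their total growth matters. -/
lemma neg_sum_step_mul_caputo_le (hα0 : 0 < α) (hα1 : α < 1) (ht : IsConvexMesh t ρ) {m : ℕ}
    (hmT : t m ≤ T) {V : ℕ → ℝ} {X : ℝ} (hV0 : ∀ j ≤ m, 0 ≤ V j) (hVX : ∀ j ≤ m, V j ≤ X) :
    -∑ n ∈ Finset.range m, (t (n + 1) - t n) * caputo α t V (n + 1) ≤
      variationConst α ρ T * X := by
  have hX : 0 ≤ X := (hV0 0 (Nat.zero_le _)).trans (hVX 0 (Nat.zero_le _))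
  have hG := gamma_two_sub_pos hα1
  have h1α : 0 < 1 - α := by linarith
  have hρ := ht.ratio_pos
  have hT : 0 ≤ T := (ht.nonneg m).trans hmT
  rw [sum_step_mul_caputo]
  rcases Nat.eq_zero_or_pos m with rfl | hm
  · simp only [Finset.range_zero, Finset.sum_empty, neg_zero, variationConst]
    positivity
  set P : ℕ → ℝ := fun k =>
    ρ ^ α / ((1 - α) * Real.Gamma (2 - α)) * (t (k + 1) - t k) ^ (1 - α) with hP
  have hPmono : ∀ k, P k ≤ P (k + 1) := fun k => by
    have := ht.step_mono k
    have := (ht.step_pos k).le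
    simp only [hP]
    gcongr
  have hP0 : ∀ k, 0 ≤ P k := fun k => by
    have := ht.step_pos k
    simp only [hP]; positivity
  have key : ∀ k, k + 1 ≤ m → -∑ i ∈ Finset.range (k + 1), columnSum α t m i * (V (i + 1) - V i) ≤
      (columnSum α t m 0 + P k - P 0) * X - columnSum α t m k * V (k + 1) := by
    intro k
    induction k with
    | zero =>
      intro _
      have h0 := mul_le_mul_of_nonneg_left (hVX 0 (Nat.zero_le _))
        (columnSum_nonneg hα0 hα1 ht m 0)
      simp only [zero_add, Finset.sum_range_one]
      linarith
    | succ k ih =>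
      intro hk
      rw [Finset.sum_range_succ, neg_add]
      have h1 := ih (by omega)
      have h2 := (columnSum_succ_le hα0 hα1 ht (show k < m by omega)).trans
        (add_le_add_right (step_sub_mul_l1Kernel_le hα0 hα1 ht k) _)
      have h3 : columnSum α t m (k + 1) - columnSum α t m k ≤ P (k + 1) - P k := by
        simp only [hP]; linarith
      have h4 := mul_le_mul_of_nonneg_right h3 (hV0 (k + 1) (by omega))
      have h5 := mul_le_mul_of_nonneg_left (hVX (k + 1) (by omega)) (sub_nonneg.2 (hPmono k))
      linarith
  obtain ⟨k, rfl⟩ : ∃ k, m = k + 1 := ⟨m - 1, by omega⟩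
  refine (key k le_rfl).trans ?_
  have h1 := mul_nonneg (columnSum_nonneg hα0 hα1 ht (k + 1) k) (hV0 (k + 1) le_rfl)
  have h2 : columnSum α t (k + 1) 0 + P k - P 0 ≤ variationConst α ρ T := by
    have h3 := columnSum_zero_le hα0 hα1 ht (k + 1)
    have h4 : t (k + 1) ^ (1 - α) ≤ T ^ (1 - α) :=
      Real.rpow_le_rpow (ht.nonneg _) hmT h1α.le
    have h5 : (t (k + 1) - t k) ^ (1 - α) ≤ T ^ (1 - α) :=
      Real.rpow_le_rpow (ht.step_pos k).le (by linarith [ht.nonneg k]) h1α.le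
    have h6 : P k ≤ ρ ^ α / ((1 - α) * Real.Gamma (2 - α)) * T ^ (1 - α) := by
      simp only [hP]; gcongr
    have h7 : 1 / ((1 - α) * Real.Gamma (2 - α)) * t (k + 1) ^ (1 - α) ≤
      1 / ((1 - α) * Real.Gamma (2 - α)) * T ^ (1 - α) := by gcongr
    rw [variationConst, add_div, add_mul]
    linarith [hP0 0]
  have := mul_le_mul_of_nonneg_right h2 hX
  linarith

end Variation

/-! ### Discrete Gronwall inequalities -/

section Gronwall

variable {α ρ T : ℝ} {t : ℕ → ℝ}

lemma le_mul_exp_of_le_add_sum (ht : IsConvexMesh t ρ) {A : ℕ → ℝ} {c L : ℝ} (hc : 0 ≤ c)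
    (hL : 0 ≤ L) {m : ℕ}
    (h : ∀ k ≤ m, A k ≤ c + L * ∑ n ∈ Finset.range k, (t (n + 1) - t n) * A n) :
    ∀ k ≤ m, A k ≤ c * Real.exp (L * t k) := by
  have key : ∀ k, c + L * ∑ n ∈ Finset.range k, (t (n + 1) - t n) * (c * Real.exp (L * t n)) ≤
      c * Real.exp (L * t k) := by
    intro k
    induction k with
    | zero => simp [ht.zero]
    | succ k ih =>
      rw [Finset.sum_range_succ, mul_add]
      have h1 : (1 + L * (t (k + 1) - t k)) * Real.exp (L * t k) ≤ Real.exp (L * t (k + 1)) := by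
        calc _ ≤ Real.exp (L * (t (k + 1) - t k)) * Real.exp (L * t k) := by
              gcongr
              linarith [Real.add_one_le_exp (L * (t (k + 1) - t k))]
          _ = _ := by rw [← Real.exp_add]; ring_nf
      have := mul_le_mul_of_nonneg_left h1 hc
      linarith
  intro k
  induction k using Nat.strong_induction_on with
  | _ k ih =>
    intro hk
    refine (h k hk).trans (le_trans ?_ (key k))
    gcongr with n hn
    · exact (ht.step_pos n).le
    · have := Finset.mem_range.1 hn
      exact ih n this (by omega)

/-- The comparison sequence: `e^{μ t_n}` for `n ≥ 1`, started from `0`. -/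
def comparison (μ : ℝ) (t : ℕ → ℝ) (n : ℕ) : ℝ := if n = 0 then 0 else Real.exp (μ * t n)

lemma comparison_le (μ : ℝ) (t : ℕ → ℝ) (n : ℕ) : comparison μ t n ≤ Real.exp (μ * t n) := by
  unfold comparison; split_ifs
  · exact (Real.exp_pos _).le
  · rfl

lemma comparison_succ (μ : ℝ) (t : ℕ → ℝ) (n : ℕ) :
    comparison μ t (n + 1) = Real.exp (μ * t (n + 1)) := by simp [comparison]

lemma exp_neg_le_rpow_neg (hα0 : 0 < α) (hα1 : α < 1) {x : ℝ} (hx : 0 < x) :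
    Real.exp (-x) ≤ x ^ (-α) := by
  have h1 : x ^ α ≤ Real.exp x := by
    calc x ^ α ≤ Real.exp x ^ α :=
          Real.rpow_le_rpow hx.le (by linarith [Real.add_one_le_exp x]) hα0.le
      _ = Real.exp (x * α) := by rw [← Real.exp_mul]
      _ ≤ Real.exp x := Real.exp_le_exp.2 (by nlinarith)
  rw [Real.exp_neg, Real.rpow_neg hx.le]
  gcongr

/-- The comparison sequence grows fast enough: its L1 quotient dominates its previous value by any
prescribed factor. Starting from `0` instead of `1` is what makes this true near `t = 0`. -/
lemma mul_exp_le_caputo_comparison (hα0 : 0 < α) (hα1 : α < 1) (ht : IsConvexMesh t ρ) {μ : ℝ}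
    (hμ : 0 < μ) (n : ℕ) :
    μ ^ α / (2 * Real.Gamma (1 - α)) * Real.exp (μ * t n) ≤
      caputo α t (comparison μ t) (n + 1) := by
  have hG : 0 < Real.Gamma (1 - α) := Real.Gamma_pos_of_pos (by linarith)
  have hinc : ∀ i, comparison μ t i ≤ comparison μ t (i + 1) := fun i => by
    rw [comparison_succ]
    have := ht.step_pos i
    exact (comparison_le μ t i).trans (Real.exp_le_exp.2 (by gcongr; linarith))
  have hsum : ∀ n, 1 / 2 * (Real.exp (μ * t (n + 1)) * Real.exp (μ * t n)) ≤
      ∑ i ∈ Finset.range (n + 1), (comparison μ t (i + 1) - comparison μ t i) *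
        Real.exp (μ * t i) := by
    intro n
    induction n with
    | zero =>
      have := mul_pos (Real.exp_pos (μ * t 1)) (Real.exp_pos (μ * t 0))
      simp only [zero_add, Finset.sum_range_one, comparison, if_true, one_ne_zero, if_false,
        sub_zero]
      linarith
    | succ n ih =>
      rw [Finset.sum_range_succ, comparison_succ, comparison_succ]
      -- convexity of `n ↦ e^{μ t_n}`, since the steps are nondecreasing
      have hconv : 2 * Real.exp (μ * t (n + 1)) ≤
          Real.exp (μ * t n) + Real.exp (μ * t (n + 2)) := by
        have h1 : Real.exp (μ * t n) =
            Real.exp (μ * t (n + 1)) * Real.exp (-(μ * (t (n + 1) - t n))) := by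
          rw [← Real.exp_add]; ring_nf
        have h2 : Real.exp (μ * t (n + 2)) =
            Real.exp (μ * t (n + 1)) * Real.exp (μ * (t (n + 2) - t (n + 1))) := by
          rw [← Real.exp_add]; ring_nf
        have h3 := Real.add_one_le_exp (-(μ * (t (n + 1) - t n)))
        have h4 := Real.add_one_le_exp (μ * (t (n + 2) - t (n + 1)))
        have h5 := mul_le_mul_of_nonneg_left (ht.step_mono n) hμ.le
        rw [h1, h2, ← mul_add, mul_comm]
        gcongr
        linarith
      have := mul_le_mul_of_nonneg_right hconv (Real.exp_pos (μ * t (n + 1))).le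
      linarith
  have hker : ∀ i ∈ Finset.range (n + 1),
      μ ^ α / Real.Gamma (1 - α) * Real.exp (-(μ * t (n + 1))) *
        ((comparison μ t (i + 1) - comparison μ t i) * Real.exp (μ * t i)) ≤
      l1Kernel α t (n + 1) i * (comparison μ t (i + 1) - comparison μ t i) := by
    intro i hi
    have hi' : i < n + 1 := Finset.mem_range.1 hi
    have hd : 0 < t (n + 1) - t i := sub_pos.2 (ht.strictMono hi')
    have h1 := exp_neg_le_rpow_neg hα0 hα1 (mul_pos hμ hd)
    rw [Real.mul_rpow hμ.le hd.le, Real.rpow_neg hμ.le, inv_mul_eq_div,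
      le_div_iff₀ (by positivity)] at h1
    have h2 := rpow_neg_le_l1Kernel hα0 hα1 ht hi'
    have h3 : μ ^ α / Real.Gamma (1 - α) * (Real.exp (-(μ * t (n + 1))) * Real.exp (μ * t i)) ≤
        l1Kernel α t (n + 1) i := by
      refine le_trans ?_ h2
      rw [← Real.exp_add, show -(μ * t (n + 1)) + μ * t i = -(μ * (t (n + 1) - t i)) by ring,
        div_mul_eq_mul_div, div_eq_inv_mul]
      gcongr
      linarith
    calc _ = μ ^ α / Real.Gamma (1 - α) * (Real.exp (-(μ * t (n + 1))) * Real.exp (μ * t i)) *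
          (comparison μ t (i + 1) - comparison μ t i) := by ring
      _ ≤ _ := mul_le_mul_of_nonneg_right h3 (sub_nonneg.2 (hinc i))
  refine le_trans ?_ (Finset.sum_le_sum hker)
  rw [← Finset.mul_sum]
  calc _ = μ ^ α / Real.Gamma (1 - α) * Real.exp (-(μ * t (n + 1))) *
        (1 / 2 * (Real.exp (μ * t (n + 1)) * Real.exp (μ * t n))) := by
        have : Real.exp (-(μ * t (n + 1))) * Real.exp (μ * t (n + 1)) = 1 := by
          rw [← Real.exp_add]; simp
        have h : ∀ E' E z g p : ℝ, E' * E = 1 → p / g * E' * (1 / 2 * (E * z)) = p / (2 * g) * z := by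
          intro E' E z g p h
          calc _ = p / g * (E' * E) * (1 / 2) * z := by ring
            _ = _ := by rw [h, mul_one, mul_one_div, div_div, mul_comm g]
        rw [h _ _ _ _ _ this]
    _ ≤ _ := by gcongr; exact hsum n

end Gronwall

/-! ### Stability from the discrete energy inequality -/

section Stability

variable {α ρ T c₀ c₁ : ℝ}

/-- The energy inequality controls the time integral of the dissipation `a` by the maximum of the
energy `V`. -/
lemma sum_step_mul_le (hα0 : 0 < α) (hα1 : α < 1) (hc₀ : 0 < c₀) (hc₁ : 0 ≤ c₁)
    {t : ℕ → ℝ} (ht : IsConvexMesh t ρ) {m : ℕ} (hmT : t m ≤ T) {V a : ℕ → ℝ} {G X : ℝ}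
    (hG : 0 ≤ G) (hV0 : ∀ j ≤ m, 0 ≤ V j) (hVX : ∀ j ≤ m, V j ≤ X)
    (h : ∀ n < m, caputo α t V (n + 1) + c₀ * a (n + 1) ≤
      G + c₁ * ∑ i ∈ Finset.range n, (t (i + 1) - t i) * a (i + 1)) :
    ∑ i ∈ Finset.range m, (t (i + 1) - t i) * a (i + 1) ≤
      (T + variationConst α ρ T) / c₀ * Real.exp (c₁ / c₀ * T) * (G + X) := by
  have hX : 0 ≤ X := (hV0 0 (Nat.zero_le _)).trans (hVX 0 (Nat.zero_le _))
  have hT : 0 ≤ T := (ht.nonneg m).trans hmT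
  have hvc : 0 ≤ variationConst α ρ T := by
    have := gamma_two_sub_pos hα1
    have : 0 < 1 - α := by linarith
    have := ht.ratio_pos
    unfold variationConst; positivity
  set A : ℕ → ℝ := fun k => ∑ i ∈ Finset.range k, (t (i + 1) - t i) * a (i + 1) with hA
  have hstep : ∀ k ≤ m, A k ≤ (T + variationConst α ρ T) / c₀ * (G + X) +
      c₁ / c₀ * ∑ n ∈ Finset.range k, (t (n + 1) - t n) * A n := by
    intro k hk
    have h1 : ∑ n ∈ Finset.range k, (t (n + 1) - t n) *
        (caputo α t V (n + 1) + c₀ * a (n + 1)) ≤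
        ∑ n ∈ Finset.range k, (t (n + 1) - t n) * (G + c₁ * A n) :=
      Finset.sum_le_sum fun n hn => mul_le_mul_of_nonneg_left
        (h n ((Finset.mem_range.1 hn).trans_le hk)) (ht.step_pos n).le
    have hkT : t k ≤ T := (ht.strictMono.monotone hk).trans hmT
    have h2 := neg_sum_step_mul_caputo_le hα0 hα1 ht hkT (V := V) (X := X)
      (fun j hj => hV0 j (hj.trans hk)) (fun j hj => hVX j (hj.trans hk))
    have h3 : ∑ n ∈ Finset.range k, (t (n + 1) - t n) *
        (caputo α t V (n + 1) + c₀ * a (n + 1)) =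
        ∑ n ∈ Finset.range k, (t (n + 1) - t n) * caputo α t V (n + 1) + c₀ * A k := by
      simp only [hA, Finset.mul_sum, ← Finset.sum_add_distrib]
      exact Finset.sum_congr rfl fun n _ => by ring
    have h4 : ∑ n ∈ Finset.range k, (t (n + 1) - t n) * (G + c₁ * A n) =
        t k * G + c₁ * ∑ n ∈ Finset.range k, (t (n + 1) - t n) * A n := by
      have : t k = ∑ n ∈ Finset.range k, (t (n + 1) - t n) := by
        rw [Finset.sum_range_sub, ht.zero, sub_zero]
      rw [this, Finset.sum_mul, Finset.mul_sum, ← Finset.sum_add_distrib]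
      exact Finset.sum_congr rfl fun n _ => by ring
    have h5 : t k * G ≤ T * G := by gcongr
    have h6 : c₀ * A k ≤ (T + variationConst α ρ T) * (G + X) +
        c₁ * ∑ n ∈ Finset.range k, (t (n + 1) - t n) * A n := by
      have := mul_nonneg hT hX
      have := mul_nonneg hvc hG
      linarith
    calc A k = (c₀ * A k) / c₀ := by field_simp
      _ ≤ ((T + variationConst α ρ T) * (G + X) +
        c₁ * ∑ n ∈ Finset.range k, (t (n + 1) - t n) * A n) / c₀ := by gcongr
      _ = _ := by ring
  have := le_mul_exp_of_le_add_sum ht (A := A) (by positivity) (by positivity) hstep m le_rfl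
  calc A m ≤ _ := this
    _ ≤ (T + variationConst α ρ T) / c₀ * (G + X) * Real.exp (c₁ / c₀ * T) := by gcongr
    _ = _ := by ring

/-- Stability of nonnegative sequences satisfying the discrete energy inequality. The argument is a
comparison principle for `V`, in which the memory term is bounded by earlier values of `V`. -/
theorem energy_stability (hα0 : 0 < α) (hα1 : α < 1) (hT : 0 < T) (hρ : 0 < ρ) (hc₀ : 0 < c₀)
    (hc₁ : 0 ≤ c₁) :
    ∃ C : ℝ, 0 < C ∧ ∀ t : ℕ → ℝ, IsConvexMesh t ρ → ∀ N : ℕ, t N ≤ T →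
      ∀ (V a : ℕ → ℝ) (G : ℝ), (∀ n, 0 ≤ V n) → (∀ n, 0 ≤ a n) → 0 ≤ G →
      (∀ n < N, caputo α t V (n + 1) + c₀ * a (n + 1) ≤
        G + c₁ * ∑ i ∈ Finset.range n, (t (i + 1) - t i) * a (i + 1)) →
      ∀ n < N, V (n + 1) ≤ C * (G + V 0) ∧
        (t (n + 1) - t n) ^ α * a (n + 1) ≤ C * (G + V 0) := by
  have hGa : 0 < Real.Gamma (1 - α) := Real.Gamma_pos_of_pos (by linarith)
  have hG2 := gamma_two_sub_pos hα1
  have h1α : 0 < 1 - α := by linarith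
  have hvc : 0 ≤ variationConst α ρ T := by unfold variationConst; positivity
  obtain ⟨C₄, hC₄⟩ : ∃ C₄, C₄ = (T + variationConst α ρ T) / c₀ * Real.exp (c₁ / c₀ * T) :=
    ⟨_, rfl⟩
  have hC₄0 : 0 ≤ C₄ := by rw [hC₄]; positivity
  obtain ⟨C₅, hC₅⟩ : ∃ C₅, C₅ = 1 + c₁ * C₄ := ⟨_, rfl⟩
  have hC₅0 : 0 < C₅ := by rw [hC₅]; positivity
  -- `μ` is chosen so that the comparison sequence beats the factor `2 C₅`
  obtain ⟨μ, hμ, hμα⟩ : ∃ μ : ℝ, 0 < μ ∧ μ ^ α / (2 * Real.Gamma (1 - α)) = 2 * C₅ := by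
    refine ⟨(2 * C₅ * (2 * Real.Gamma (1 - α))) ^ (α⁻¹), by positivity, ?_⟩
    rw [Real.rpow_inv_rpow (by positivity) hα0.ne', mul_div_assoc, div_self (by positivity),
      mul_one]
  obtain ⟨E, hE⟩ : ∃ E, E = 1 + Real.exp (μ * T) := ⟨_, rfl⟩
  have hE1 : 1 ≤ E := by rw [hE]; linarith [Real.exp_pos (μ * T)]
  refine ⟨E + (T ^ α * C₅ * (1 + E) + (Real.Gamma (2 - α))⁻¹ * E) / c₀, by positivity, ?_⟩
  intro t ht N hN V a G hV ha hG h
  have hK : 0 ≤ G + V 0 := add_nonneg hG (hV 0)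
  have hrhs : ∀ n < N, ∀ X, (∀ j ≤ n, V j ≤ X) →
      caputo α t V (n + 1) + c₀ * a (n + 1) ≤ C₅ * (G + X) := by
    intro n hn X hX
    have hX0 : 0 ≤ X := (hV 0).trans (hX 0 (Nat.zero_le _))
    have h1 := sum_step_mul_le hα0 hα1 hc₀ hc₁ ht
      ((ht.strictMono.monotone hn.le).trans hN) hG (fun j _ => hV j) hX
      (fun k hk => h k (hk.trans hn))
    rw [← hC₄] at h1
    have h2 := mul_le_mul_of_nonneg_left h1 hc₁
    have h3 := h n hn
    rw [hC₅]
    linarith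
  have hcomp : ∀ n ≤ N, V n ≤ V 0 + (G + V 0) * comparison μ t n := by
    intro n
    induction n using Nat.strong_induction_on with
    | _ n ih =>
      intro hn
      rcases n with _ | n
      · simp [comparison]
      have hX : ∀ j ≤ n, V j ≤ V 0 + (G + V 0) * Real.exp (μ * t n) := by
        intro j hj
        refine (ih j (by omega) (by omega)).trans ?_
        have h1 : comparison μ t j ≤ Real.exp (μ * t n) :=
          (comparison_le μ t j).trans (Real.exp_le_exp.2
            (mul_le_mul_of_nonneg_left (ht.strictMono.monotone hj) hμ.le))
        gcongr
      have h1 := hrhs n hn _ hX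
      have h2 := mul_exp_le_caputo_comparison hα0 hα1 ht hμ n
      rw [hμα] at h2
      have hz : 1 ≤ Real.exp (μ * t n) := Real.one_le_exp (mul_nonneg hμ.le (ht.nonneg n))
      have h3 : caputo α t V (n + 1) ≤ (G + V 0) * caputo α t (comparison μ t) (n + 1) := by
        have h4 := mul_le_mul_of_nonneg_left h2 hK
        have h5 := mul_nonneg hc₀.le (ha (n + 1))
        have h6 := mul_le_mul_of_nonneg_left hz (mul_nonneg hC₅0.le hK)
        linarith
      have h4 := caputo_succ_le hα0 hα1 ht (n := n)
        (W := fun j => (V 0 + (G + V 0) * comparison μ t j) - V j)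
        (fun j hj => sub_nonneg.2 (ih j (by omega) (by omega)))
      rw [caputo_sub (fun j => V 0 + (G + V 0) * comparison μ t j) V, caputo_const_add_mul] at h4
      have h5 := (sub_nonneg.2 h3).trans h4
      exact sub_nonneg.1 (nonneg_of_mul_nonneg_right h5
        (l1Kernel_pos hα0 hα1 ht (Nat.lt_succ_self n)))
  have hbound : ∀ n ≤ N, V n ≤ E * (G + V 0) := by
    intro n hn
    refine (hcomp n hn).trans ?_
    have h1 : comparison μ t n ≤ Real.exp (μ * T) :=
      (comparison_le μ t n).trans (Real.exp_le_exp.2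
        (mul_le_mul_of_nonneg_left ((ht.strictMono.monotone hn).trans hN) hμ.le))
    have h2 := mul_le_mul_of_nonneg_left h1 hK
    rw [hE]
    linarith
  intro n hn
  refine ⟨(hbound (n + 1) hn).trans ?_, ?_⟩
  · gcongr
    exact le_add_of_nonneg_right (by positivity)
  · have hX : ∀ j ≤ n, V j ≤ E * (G + V 0) := fun j hj => hbound j (hj.trans hn.le)
    have h1 := hrhs n hn _ hX
    have h2 := caputo_succ_le hα0 hα1 ht (n := n)
      (W := fun j => (E * (G + V 0) + 0 * V j) - V j)
      (fun j hj => by have := hX j hj; linarith)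
    rw [caputo_sub (fun j => E * (G + V 0) + 0 * V j) V, caputo_const_add_mul] at h2
    have hτ := ht.step_pos n
    have hτα : (t (n + 1) - t n) ^ α * l1Kernel α t (n + 1) n = (Real.Gamma (2 - α))⁻¹ := by
      rw [l1Kernel_self hα1 ht, Real.rpow_neg hτ.le]
      have : (t (n + 1) - t n) ^ α ≠ 0 := by positivity
      field_simp
    have hτT : (t (n + 1) - t n) ^ α ≤ T ^ α := by
      refine Real.rpow_le_rpow hτ.le ?_ hα0.le
      have := ht.strictMono.monotone (show n + 1 ≤ N from hn)
      linarith [ht.nonneg n]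
    have h3 : c₀ * a (n + 1) ≤ C₅ * (G + E * (G + V 0)) +
        l1Kernel α t (n + 1) n * (E * (G + V 0)) := by
      have := mul_nonneg (l1Kernel_pos hα0 hα1 ht (Nat.lt_succ_self n)).le (hV (n + 1))
      simp only [Nat.succ_eq_add_one] at this
      linarith
    have h4 : C₅ * (G + E * (G + V 0)) ≤ C₅ * (1 + E) * (G + V 0) := by
      have := mul_nonneg hC₅0.le (hV 0)
      linarith
    have h5 : c₀ * ((t (n + 1) - t n) ^ α * a (n + 1)) ≤
        (T ^ α * C₅ * (1 + E) + (Real.Gamma (2 - α))⁻¹ * E) * (G + V 0) := by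
      calc _ = (t (n + 1) - t n) ^ α * (c₀ * a (n + 1)) := by ring
        _ ≤ (t (n + 1) - t n) ^ α * (C₅ * (1 + E) * (G + V 0) +
            l1Kernel α t (n + 1) n * (E * (G + V 0))) := by
          gcongr; linarith
        _ = (t (n + 1) - t n) ^ α * (C₅ * (1 + E) * (G + V 0)) +
            ((t (n + 1) - t n) ^ α * l1Kernel α t (n + 1) n) * (E * (G + V 0)) := by ring
        _ ≤ T ^ α * (C₅ * (1 + E) * (G + V 0)) +
            (Real.Gamma (2 - α))⁻¹ * (E * (G + V 0)) := by
          rw [hτα]; gcongr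
        _ = _ := by ring
    calc _ = c₀ * ((t (n + 1) - t n) ^ α * a (n + 1)) / c₀ := by field_simp
      _ ≤ (T ^ α * C₅ * (1 + E) + (Real.Gamma (2 - α))⁻¹ * E) * (G + V 0) / c₀ := by gcongr
      _ = (T ^ α * C₅ * (1 + E) + (Real.Gamma (2 - α))⁻¹ * E) / c₀ * (G + V 0) := by ring
      _ ≤ _ := by gcongr; linarith

end Stability

/-! ### The Poincaré inequality and the boundedness of the memory form -/

lemma integral_norm_mul_norm_le {X E F : Type*} [MeasurableSpace X] {μ : Measure X}
    [NormedAddCommGroup E] [NormedAddCommGroup F] (U : Lp E 2 μ) (V : Lp F 2 μ) :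
    Integrable (fun x => ‖U x‖ * ‖V x‖) μ ∧ ∫ x, ‖U x‖ * ‖V x‖ ∂μ ≤ ‖U‖ * ‖V‖ := by
  have hU := (Lp.memLp U).norm
  have hV := (Lp.memLp V).norm
  have h : ⇑(hU.toLp _) =ᵐ[μ] fun x => ‖U x‖ := hU.coeFn_toLp
  have h' : ⇑(hV.toLp _) =ᵐ[μ] fun x => ‖V x‖ := hV.coeFn_toLp
  have hae : (fun x => inner ℝ (hU.toLp _ x) (hV.toLp _ x)) =ᵐ[μ] fun x => ‖U x‖ * ‖V x‖ := by
    filter_upwards [h, h'] with x hx hx'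
    rw [hx, hx', RCLike.inner_apply, conj_trivial, mul_comm]
  refine ⟨(L2.integrable_inner (𝕜 := ℝ) (hU.toLp _) (hV.toLp _)).congr hae, ?_⟩
  rw [← integral_congr_ae hae, ← L2.inner_def]
  refine (real_inner_le_norm _ _).trans_eq ?_
  rw [Lp.norm_toLp, Lp.norm_toLp, eLpNorm_norm, eLpNorm_norm, Lp.norm_def, Lp.norm_def]

section Poincare

variable {d : ℕ} {Ω : Set (Eucl d)}

lemma IsTestFunction.eq_zero_of_notMem {φ : Eucl d → ℝ} (hφ : IsTestFunction Ω φ) {x : Eucl d}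
    (hx : x ∉ Ω) : φ x = 0 :=
  image_eq_zero_of_notMem_tsupport fun h => hx (hφ.2.2 h)

lemma isTestFunction_zero : IsTestFunction Ω (0 : Eucl d → ℝ) :=
  ⟨contDiff_const, HasCompactSupport.zero, by simp [tsupport]⟩

lemma IsTestFunction.add {φ ψ : Eucl d → ℝ} (hφ : IsTestFunction Ω φ) (hψ : IsTestFunction Ω ψ) :
    IsTestFunction Ω (φ + ψ) :=
  ⟨hφ.1.add hψ.1, hφ.2.1.add hψ.2.1, (tsupport_add φ ψ).trans (union_subset hφ.2.2 hψ.2.2)⟩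

lemma IsTestFunction.const_smul {φ : Eucl d → ℝ} (hφ : IsTestFunction Ω φ) (c : ℝ) :
    IsTestFunction Ω (c • φ) := by
  refine ⟨hφ.1.const_smul c, hφ.2.1.smul_left (f := fun _ => c), ?_⟩
  exact (tsupport_smul_subset_right (fun _ => c) φ).trans hφ.2.2

lemma IsTestFunction.differentiableAt {φ : Eucl d → ℝ} (hφ : IsTestFunction Ω φ) (x : Eucl d) :
    DifferentiableAt ℝ φ x :=
  (hφ.1.differentiable (by simp)).differentiableAt

/-- The pairs `(φ, ∇φ)` already form a linear space, so the span in the definition of `H10` adds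
nothing. -/
lemma mem_testPairs_of_mem_span {U : L2 Ω × L2Vec Ω} (hU : U ∈ Submodule.span ℝ (testPairs Ω)) :
    U ∈ testPairs Ω := by
  induction hU using Submodule.span_induction with
  | mem U h => exact h
  | zero =>
    refine ⟨0, isTestFunction_zero, Lp.coeFn_zero _ _ _, ?_⟩
    filter_upwards [Lp.coeFn_zero (Eucl d) 2 (volume.restrict Ω)] with x hx
    simpa [gradient] using hx
  | add U V _ _ hU hV =>
    obtain ⟨φ, hφ, h1, h2⟩ := hU
    obtain ⟨ψ, hψ, k1, k2⟩ := hV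
    refine ⟨φ + ψ, hφ.add hψ, (Lp.coeFn_add _ _).trans (h1.add k1), ?_⟩
    filter_upwards [Lp.coeFn_add U.2 V.2, h2, k2] with x hx hx2 kx2
    have : gradient (φ + ψ) x = gradient φ x + gradient ψ x := by
      simp only [gradient, fderiv_add (hφ.differentiableAt x) (hψ.differentiableAt x), map_add]
    rw [this, ← hx2, ← kx2]
    exact hx
  | smul c U _ hU =>
    obtain ⟨φ, hφ, h1, h2⟩ := hU
    refine ⟨c • φ, hφ.const_smul c, (Lp.coeFn_smul _ _).trans (h1.const_smul c), ?_⟩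
    filter_upwards [Lp.coeFn_smul c U.2, h2] with x hx hx2
    have : gradient (c • φ) x = c • gradient φ x := by
      simp only [gradient, fderiv_const_smul (hφ.differentiableAt x), map_smul]
    rw [this, ← hx2]
    exact hx

/-- Integration by parts of `φ² ∂ᵢ xᵢ`. -/
lemma IsTestFunction.integral_sq_le {φ : Eucl d → ℝ} (hφ : IsTestFunction Ω φ) (i : Fin d) {R : ℝ}
    (hR : ∀ x ∈ Ω, |x i| ≤ R) :
    ∫ x in Ω, φ x ^ 2 ≤ 2 * R * ∫ x in Ω, |φ x| * ‖gradient φ x‖ := by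
  set v : Eucl d := EuclideanSpace.single i 1 with hv
  have hvn : ‖v‖ = 1 := by simp [hv]
  have hc := hφ.1.continuous
  have hdc : Continuous (fderiv ℝ φ) := hφ.1.continuous_fderiv (by simp)
  have hgc : Continuous (gradient φ) :=
    (LinearIsometryEquiv.continuous _).comp hdc
  have hsq : HasCompactSupport (fun x => φ x * φ x) := hφ.2.1.mul_right
  have hfd : ∀ x, fderiv ℝ (fun x => φ x * φ x) x v = 2 * (φ x * fderiv ℝ φ x v) := by
    intro x
    rw [fderiv_fun_mul (hφ.differentiableAt x) (hφ.differentiableAt x)]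
    simp; ring
  have hproj : ∀ x, fderiv ℝ (fun x : Eucl d => x i) x v = 1 := by
    intro x
    have : (fun x : Eucl d => x i) = ⇑(EuclideanSpace.proj i : Eucl d →L[ℝ] ℝ) :=
      rfl
    rw [this, ContinuousLinearMap.fderiv]
    simp [hv]
  have hxc : Continuous (fun x : Eucl d => x i) :=
    (EuclideanSpace.proj i : Eucl d →L[ℝ] ℝ).continuous
  have hint₁ : Integrable (fun x => 2 * (φ x * fderiv ℝ φ x v) * x i) := by
    refine Continuous.integrable_of_hasCompactSupport (by fun_prop) ?_
    exact ((hφ.2.1.mul_right (f' := fun x => fderiv ℝ φ x v)).mul_left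
      (f := fun _ => (2 : ℝ))).mul_right (f' := fun x : Eucl d => x i)
  have hparts := integral_mul_fderiv_eq_neg_fderiv_mul_of_integrable
    (μ := (volume : Measure (Eucl d)))
    (f := fun x => φ x * φ x) (g := fun x : Eucl d => x i) (v := v)
    (by simpa only [hfd] using hint₁)
    (by
      simp only [hproj, mul_one]
      exact Continuous.integrable_of_hasCompactSupport (by fun_prop) hsq)
    (Continuous.integrable_of_hasCompactSupport (by fun_prop) hsq.mul_right)
    (fun x _ => (hφ.differentiableAt x).mul (hφ.differentiableAt x))
    (fun x _ => (EuclideanSpace.proj i : Eucl d →L[ℝ] ℝ).differentiableAt)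
  simp only [hproj, mul_one, hfd] at hparts
  have hint₂ : Integrable (fun x => 2 * R * (|φ x| * ‖gradient φ x‖)) := by
    refine (Continuous.integrable_of_hasCompactSupport (by fun_prop) ?_).const_mul _
    exact (hφ.2.1.comp_left (g := fun y : ℝ => |y|) abs_zero).mul_right
  rw [← integral_const_mul]
  rw [setIntegral_eq_integral_of_forall_compl_eq_zero
      (fun x hx => by rw [hφ.eq_zero_of_notMem hx]; simp),
    setIntegral_eq_integral_of_forall_compl_eq_zero
      (fun x hx => by rw [hφ.eq_zero_of_notMem hx]; simp)]
  simp only [pow_two]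
  rw [hparts, ← integral_neg]
  refine integral_mono hint₁.neg hint₂ fun x => ?_
  by_cases hx : x ∈ Ω
  · have h1 : |fderiv ℝ φ x v| ≤ ‖gradient φ x‖ := by
      rw [← inner_gradient_left]
      refine (abs_real_inner_le_norm _ _).trans_eq ?_
      rw [hvn, mul_one]
    calc _ ≤ |2 * (φ x * fderiv ℝ φ x v) * x i| := neg_le_abs _
      _ = 2 * |φ x| * |fderiv ℝ φ x v| * |x i| := by
        rw [abs_mul, abs_mul, abs_mul, abs_two]; ring
      _ ≤ 2 * |φ x| * ‖gradient φ x‖ * R := by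
        gcongr
        exact hR x hx
      _ = _ := by ring
  · simp [hφ.eq_zero_of_notMem hx]

lemma L2_norm_sq {X : Type*} [MeasurableSpace X] {μ : Measure X} (U : Lp ℝ 2 μ) :
    ‖U‖ ^ 2 = ∫ x, U x ^ 2 ∂μ := by
  rw [← real_inner_self_eq_norm_sq, L2.inner_def]
  simp [pow_two]

/-- The Poincaré inequality on `H¹₀` of a bounded domain. -/
lemma exists_norm_le_mul_norm_gradient (hd : 1 ≤ d) (hΩ : Bornology.IsBounded Ω) :
    ∃ CP : ℝ, 0 < CP ∧ ∀ U ∈ H10 Ω, ‖U.1‖ ≤ CP * ‖U.2‖ := by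
  obtain ⟨R, hR0, hR⟩ := hΩ.exists_pos_norm_le
  refine ⟨2 * R, by positivity, fun U hU => ?_⟩
  have hclosed : IsClosed {U : L2 Ω × L2Vec Ω | ‖U.1‖ ≤ 2 * R * ‖U.2‖} :=
    isClosed_le (by fun_prop) (by fun_prop)
  have hsub : (Submodule.span ℝ (testPairs Ω) : Set (L2 Ω × L2Vec Ω)) ⊆
      {U | ‖U.1‖ ≤ 2 * R * ‖U.2‖} := by
    intro U hU
    obtain ⟨φ, hφ, h1, h2⟩ := mem_testPairs_of_mem_span hU
    have hi := hφ.integral_sq_le ⟨0, hd⟩ (R := R)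
      (fun x hx => (PiLp.norm_apply_le x _).trans (hR x hx))
    have e1 : ∫ x in Ω, φ x ^ 2 = ‖U.1‖ ^ 2 := by
      rw [L2_norm_sq]
      refine integral_congr_ae ?_
      filter_upwards [h1] with x hx
      rw [hx]
    have e2 : ∫ x in Ω, |φ x| * ‖gradient φ x‖ = ∫ x in Ω, ‖U.1 x‖ * ‖U.2 x‖ := by
      refine integral_congr_ae ?_
      filter_upwards [h1, h2] with x hx hx2
      rw [hx, hx2, Real.norm_eq_abs]
    rw [e1, e2] at hi
    have h3 := (integral_norm_mul_norm_le U.1 U.2).2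
    have h4 : ‖U.1‖ * ‖U.1‖ ≤ ‖U.1‖ * (2 * R * ‖U.2‖) := by
      calc _ = ‖U.1‖ ^ 2 := (pow_two _).symm
        _ ≤ _ := hi
        _ ≤ 2 * R * (‖U.1‖ * ‖U.2‖) := by gcongr
        _ = _ := by ring
    rcases (norm_nonneg U.1).eq_or_lt with h0 | h0
    · show ‖U.1‖ ≤ _
      rw [← h0]
      positivity
    · exact le_of_mul_le_mul_left h4 h0
  exact closure_minimal hsub hclosed hU

lemma abs_integral_le_of_abs_le {X E F : Type*} [MeasurableSpace X] {μ : Measure X}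
    [NormedAddCommGroup E] [NormedAddCommGroup F] (U : Lp E 2 μ) (V : Lp F 2 μ) {g : X → ℝ}
    {c : ℝ} (hc : 0 ≤ c) (hg : ∀ᵐ x ∂μ, |g x| ≤ c * (‖U x‖ * ‖V x‖)) :
    |∫ x, g x ∂μ| ≤ c * (‖U‖ * ‖V‖) := by
  obtain ⟨hi, hle⟩ := integral_norm_mul_norm_le U V
  have hg' : ∀ᵐ x ∂μ, ‖g x‖ ≤ c * (‖U x‖ * ‖V x‖) := hg
  refine (norm_integral_le_of_norm_le (hi.const_mul c) hg').trans ?_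
  rw [integral_const_mul]
  gcongr

/-- The memory form is bounded by the gradient norms, uniformly in time. -/
lemma exists_abs_form_le (hd : 1 ≤ d) (hΩo : IsOpen Ω) (hΩ : Bornology.IsBounded Ω) {T : ℝ}
    {b : MemoryCoeffs d} (hb : b.Admissible Ω T) :
    ∃ CB : ℝ, 0 < CB ∧ ∀ s ∈ Icc 0 T, ∀ r ∈ Icc 0 T, ∀ U ∈ H10 Ω, ∀ V ∈ H10 Ω,
      |b.form s r U V| ≤ CB * (‖U.2‖ * ‖V.2‖) := by
  obtain ⟨CP, hCP, hP⟩ := exists_norm_le_mul_norm_gradient hd hΩ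
  have hK : IsCompact (closure Ω ×ˢ Icc 0 T ×ˢ Icc (0 : ℝ) T) :=
    hΩ.isCompact_closure.prod (isCompact_Icc.prod isCompact_Icc)
  choose c2 hc2 using fun i j => hK.exists_bound_of_continuousOn (hb.smooth_b2 i j).continuousOn
  obtain ⟨c1, hc1⟩ := hK.exists_bound_of_continuousOn hb.smooth_b1.continuousOn
  obtain ⟨c0, hc0⟩ := hK.exists_bound_of_continuousOn hb.smooth_b0.continuousOn
  refine ⟨∑ i, ∑ j, |c2 i j| + CP * (d * |c1|) + CP * CP * |c0| + 1, by positivity, ?_⟩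
  intro s hs r hr U hU V hV
  have hmem : ∀ x ∈ Ω, ((x, s, r) : Eucl d × ℝ × ℝ) ∈ closure Ω ×ˢ Icc 0 T ×ˢ Icc (0 : ℝ) T :=
    fun x hx => ⟨subset_closure hx, hs, hr⟩
  have hΩm : ∀ᵐ x ∂(volume.restrict Ω), x ∈ Ω := ae_restrict_mem hΩo.measurableSet
  have t2 : |∫ x in Ω, ∑ i, ∑ j, b.b2 x s r i j * U.2 x j * V.2 x i| ≤
      (∑ i, ∑ j, |c2 i j|) * (‖U.2‖ * ‖V.2‖) := by
    refine abs_integral_le_of_abs_le U.2 V.2 (by positivity) ?_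
    filter_upwards [hΩm] with x hx
    rw [Finset.sum_mul]
    refine (Finset.abs_sum_le_sum_abs _ _).trans (Finset.sum_le_sum fun i _ => ?_)
    rw [Finset.sum_mul]
    refine (Finset.abs_sum_le_sum_abs _ _).trans (Finset.sum_le_sum fun j _ => ?_)
    rw [abs_mul, abs_mul, mul_assoc]
    refine mul_le_mul ?_ (mul_le_mul ?_ ?_ (abs_nonneg _) (norm_nonneg _)) (by positivity)
      (abs_nonneg _)
    · exact (hc2 i j _ (hmem x hx)).trans (le_abs_self _)
    · exact PiLp.norm_apply_le (U.2 x) j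
    · exact PiLp.norm_apply_le (V.2 x) i
  have t1 : |∫ x in Ω, U.1 x * ∑ i, b.b1 x s r i * V.2 x i| ≤
      (d * |c1|) * (‖U.1‖ * ‖V.2‖) := by
    refine abs_integral_le_of_abs_le U.1 V.2 (by positivity) ?_
    filter_upwards [hΩm] with x hx
    have h1 : |∑ i, b.b1 x s r i * V.2 x i| ≤ ∑ _i : Fin d, |c1| * ‖V.2 x‖ := by
      refine (Finset.abs_sum_le_sum_abs _ _).trans (Finset.sum_le_sum fun i _ => ?_)
      rw [abs_mul]
      refine mul_le_mul ?_ ?_ (abs_nonneg _) (abs_nonneg _)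
      · exact (PiLp.norm_apply_le (b.b1 x s r) i).trans
          ((hc1 _ (hmem x hx)).trans (le_abs_self _))
      · exact PiLp.norm_apply_le (V.2 x) i
    rw [Finset.sum_const, Finset.card_univ, Fintype.card_fin, nsmul_eq_mul] at h1
    rw [abs_mul, ← Real.norm_eq_abs (U.1 x)]
    calc _ ≤ ‖U.1 x‖ * (d * (|c1| * ‖V.2 x‖)) := by gcongr
      _ = _ := by ring
  have t0 : |∫ x in Ω, b.b0 x s r * U.1 x * V.1 x| ≤ |c0| * (‖U.1‖ * ‖V.1‖) := by
    refine abs_integral_le_of_abs_le U.1 V.1 (by positivity) ?_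
    filter_upwards [hΩm] with x hx
    rw [abs_mul, abs_mul, mul_assoc, Real.norm_eq_abs, Real.norm_eq_abs]
    refine mul_le_mul_of_nonneg_right ?_ (by positivity)
    exact (hc0 _ (hmem x hx)).trans (le_abs_self _)
  have hU1 := hP U hU
  have hV1 := hP V hV
  have s1 : (d * |c1|) * (‖U.1‖ * ‖V.2‖) ≤ CP * (d * |c1|) * (‖U.2‖ * ‖V.2‖) := by
    calc _ ≤ (d * |c1|) * ((CP * ‖U.2‖) * ‖V.2‖) := by gcongr
      _ = _ := by ring
  have s0 : |c0| * (‖U.1‖ * ‖V.1‖) ≤ CP * CP * |c0| * (‖U.2‖ * ‖V.2‖) := by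
    calc _ ≤ |c0| * ((CP * ‖U.2‖) * (CP * ‖V.2‖)) := by gcongr
      _ = _ := by ring
  have hnn : 0 ≤ ‖U.2‖ * ‖V.2‖ := by positivity
  rw [MemoryCoeffs.form]
  refine (abs_add_le _ _).trans ?_
  have h3 := abs_sub (∫ x in Ω, ∑ i, ∑ j, b.b2 x s r i j * U.2 x j * V.2 x i)
    (∫ x in Ω, U.1 x * ∑ i, b.b1 x s r i * V.2 x i)
  linarith

end Poincare

/-! ### The graded mesh -/

section GradedMesh

variable {T δ α : ℝ} {N : ℕ}

lemma step_succ (T δ : ℝ) (N n : ℕ) : step T δ N (n + 1) = node T δ N (n + 1) - node T δ N n := by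
  rw [step, Nat.add_sub_cancel]

lemma node_last (T δ : ℝ) (hN : 1 ≤ N) : node T δ N N = T := by
  have : (N : ℝ) ≠ 0 := by positivity
  rw [node, div_self this, Real.one_rpow, mul_one]

/-- The ratio of consecutive steps of the graded mesh is at most `δ 2^(δ-1)`, uniformly in `N`. -/
lemma isConvexMesh_node (hT : 0 < T) (hδ : 1 ≤ δ) (hN : 1 ≤ N) :
    IsConvexMesh (node T δ N) (δ * 2 ^ (δ - 1)) := by
  have hN0 : (0 : ℝ) < N := by positivity
  have hc : 0 < T / (N : ℝ) ^ δ := by positivity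
  have hnode : ∀ n : ℕ, node T δ N n = T / (N : ℝ) ^ δ * (n : ℝ) ^ δ := fun n => by
    rw [node, Real.div_rpow (by positivity) hN0.le]; ring
  have hδ0 : 0 < δ := by linarith
  refine ⟨?_, fun n => ?_, fun n => ?_, fun n => ?_⟩
  · rw [hnode, Nat.cast_zero, Real.zero_rpow hδ0.ne', mul_zero]
  · rw [hnode, hnode]
    gcongr
    exact Nat.lt_succ_self n
  · simp only [hnode, ← mul_sub]
    refine mul_le_mul_of_nonneg_left ?_ hc.le
    have h := (convexOn_rpow hδ).slope_mono_adjacent (x := (n : ℝ)) (y := (n : ℝ) + 1)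
      (z := (n : ℝ) + 2) (mem_Ici.2 (by positivity)) (mem_Ici.2 (by positivity))
      (by linarith) (by linarith)
    rw [show (n : ℝ) + 1 - n = 1 by ring, show (n : ℝ) + 2 - (n + 1) = 1 by ring,
      div_one, div_one] at h
    push_cast
    exact h
  · simp only [hnode, ← mul_sub]
    rw [mul_left_comm]
    refine mul_le_mul_of_nonneg_left ?_ hc.le
    push_cast
    have hn : (0 : ℝ) ≤ n := by positivity
    have hpow : ∀ x : ℝ, 0 < x → x ^ δ = x ^ (δ - 1) * x := fun x hx => by
      rw [← Real.rpow_add_one hx.ne']; ring_nf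
    have hup : ((n : ℝ) + 2) ^ δ - ((n : ℝ) + 1) ^ δ ≤ δ * ((n : ℝ) + 2) ^ (δ - 1) := by
      have hx : (0 : ℝ) < n + 2 := by positivity
      have hB := one_add_mul_self_le_rpow_one_add (s := ((n : ℝ) + 1) / (n + 2) - 1) (p := δ)
        (by linarith [show (0 : ℝ) ≤ (n + 1) / (n + 2) by positivity]) hδ
      rw [add_sub_cancel, Real.div_rpow (by positivity) hx.le, le_div_iff₀ (by positivity)] at hB
      have e : (1 + δ * (((n : ℝ) + 1) / (n + 2) - 1)) * (n + 2) ^ δ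
          = (n + 2) ^ δ - δ * ((n : ℝ) + 2) ^ (δ - 1) := by
        rw [hpow _ hx]; field_simp; ring
      linarith
    have hlow : ((n : ℝ) + 1) ^ (δ - 1) ≤ ((n : ℝ) + 1) ^ δ - (n : ℝ) ^ δ := by
      rcases hn.eq_or_lt with h0 | h0
      · rw [← h0, Real.zero_rpow hδ0.ne']; simp
      · rw [hpow _ h0, hpow _ (by linarith : (0 : ℝ) < n + 1)]
        have : (n : ℝ) ^ (δ - 1) ≤ ((n : ℝ) + 1) ^ (δ - 1) :=
          Real.rpow_le_rpow hn (by linarith) (by linarith)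
        nlinarith
    calc _ ≤ δ * ((n : ℝ) + 2) ^ (δ - 1) := hup
      _ ≤ δ * (2 * ((n : ℝ) + 1)) ^ (δ - 1) := by
        refine mul_le_mul_of_nonneg_left ?_ hδ0.le
        exact Real.rpow_le_rpow (by positivity) (by linarith) (by linarith)
      _ = δ * 2 ^ (δ - 1) * ((n : ℝ) + 1) ^ (δ - 1) := by
        rw [Real.mul_rpow (by norm_num) (by positivity)]; ring
      _ ≤ _ := by gcongr

lemma node_mem_Icc (hT : 0 < T) (hδ : 1 ≤ δ) (hN : 1 ≤ N) {n : ℕ} (hn : n ≤ N) :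
    node T δ N n ∈ Icc 0 T := by
  have h := isConvexMesh_node hT hδ hN
  refine ⟨h.nonneg n, ?_⟩
  conv_rhs => rw [← node_last T δ hN]
  exact h.strictMono.monotone hn

lemma kernel_succ_eq_l1Kernel (hα1 : α < 1) {n i : ℕ} :
    kernel α T δ N n (i + 1) = l1Kernel α (node T δ N) n i := by
  have hG : Real.Gamma (1 - α) ≠ 0 := (Real.Gamma_pos_of_pos (by linarith)).ne'
  have h1 : 1 - α ≠ 0 := by linarith
  rw [kernel, Nat.add_sub_cancel, step_succ,
    intervalIntegral.integral_comp_sub_left (fun s => s ^ (-α)),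
    integral_rpow (Or.inl (by linarith)), l1Kernel, gamma_two_sub hα1,
    show -α + 1 = 1 - α by ring]
  simp only [div_eq_mul_inv, mul_inv]
  ring

lemma discreteCaputo_eq_sum {d : ℕ} {Ω : Set (Eucl d)} (hα1 : α < 1)
    (u : ℕ → L2 Ω × L2Vec Ω) (n : ℕ) :
    discreteCaputo α T δ N u n =
      ∑ i ∈ Finset.range n, l1Kernel α (node T δ N) n i • ((u (i + 1)).1 - (u i).1) := by
  rw [discreteCaputo, ← Finset.Ico_add_one_right_eq_Icc, Finset.sum_Ico_eq_sum_range,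
    Nat.add_sub_cancel]
  refine Finset.sum_congr rfl fun i _ => ?_
  rw [add_comm 1 i, kernel_succ_eq_l1Kernel hα1, Nat.add_sub_cancel]

end GradedMesh

/-! ### The energy inequality for the scheme -/

section Energy

variable {d : ℕ} {Ω : Set (Eucl d)} {T δ α m0 CP CB : ℝ} {N : ℕ}

lemma AssumptionA2.le_of_nonneg {M : ℝ → ℝ} {u0 : L2 Ω × L2Vec Ω} {f : ℝ → L2 Ω}
    (h : AssumptionA2 T m0 M u0 f) {s : ℝ} (hs : 0 ≤ s) : m0 ≤ M s := by
  rcases hs.eq_or_lt with rfl | hs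
  · obtain ⟨L, hL, -⟩ := h.lipschitz
    have hc : Filter.Tendsto M (nhdsWithin 0 (Ioi 0)) (nhds (M 0)) :=
      (hL.continuousOn 0 self_mem_Ici).mono_left (nhdsWithin_mono _ Ioi_subset_Ici_self)
    exact ge_of_tendsto hc (by filter_upwards [self_mem_nhdsWithin] with s hs using h.lower s hs)
  · exact h.lower s hs

lemma abs_quadForm_le {b : MemoryCoeffs d} (hT : 0 < T) (hδ : 1 ≤ δ) (hN : 1 ≤ N)
    (hCB : 0 ≤ CB) (hB : ∀ s ∈ Icc 0 T, ∀ r ∈ Icc 0 T, ∀ U ∈ H10 Ω, ∀ V ∈ H10 Ω,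
      |b.form s r U V| ≤ CB * (‖U.2‖ * ‖V.2‖))
    {u : ℕ → L2 Ω × L2Vec Ω} (hu : ∀ n ≤ N, u n ∈ H10 Ω) {n i : ℕ} (hn : n < N) (hi : i < n) :
    |quadForm b T δ N u (n + 1) (i + 1) (u (n + 1))| ≤
      CB * ‖(u (n + 1)).2‖ * (‖(u (i + 1)).2‖ + if i + 1 < n then ‖(u (i + 2)).2‖ else 0) := by
  have hform : ∀ j ≤ n, |b.form (node T δ N (n + 1)) (node T δ N j) (u j) (u (n + 1))| ≤
      CB * (‖(u j).2‖ * ‖(u (n + 1)).2‖) := fun j hj =>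
    hB _ (node_mem_Icc hT hδ hN hn) _ (node_mem_Icc hT hδ hN (hj.trans hn.le)) _
      (hu _ (hj.trans hn.le)) _ (hu _ hn)
  rw [quadForm]
  by_cases h : i + 1 < n
  · rw [if_pos (by omega), if_pos h, abs_mul, abs_of_nonneg (by norm_num : (0 : ℝ) ≤ 1 / 2)]
    have h1 := hform (i + 1) (by omega)
    have h2 := hform (i + 2) (by omega)
    have h3 := abs_add_le (b.form (node T δ N (n + 1)) (node T δ N (i + 1)) (u (i + 1)) (u (n + 1)))
      (b.form (node T δ N (n + 1)) (node T δ N (i + 2)) (u (i + 2)) (u (n + 1)))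
    have h4 : 0 ≤ CB * (‖(u (i + 1)).2‖ * ‖(u (n + 1)).2‖) := by positivity
    have h5 : 0 ≤ CB * (‖(u (i + 2)).2‖ * ‖(u (n + 1)).2‖) := by positivity
    have h6 : i + 1 + 1 = i + 2 := rfl
    rw [h6]
    linarith
  · have hin : n = i + 1 := by omega
    rw [if_neg (by omega), if_neg h, add_zero, Nat.add_sub_cancel]
    refine (hform n le_rfl).trans_eq ?_
    rw [hin]; ring

/-- Cauchy–Schwarz for the memory sum. The factor `1 + ρ` comes from the values at both endpoints
of a cell in the quadrature rule, `ρ` bounding the ratio of consecutive steps. -/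
lemma sum_quadForm_le {b : MemoryCoeffs d} (hT : 0 < T) (hδ : 1 ≤ δ) (hN : 1 ≤ N)
    (hCB : 0 ≤ CB) (hB : ∀ s ∈ Icc 0 T, ∀ r ∈ Icc 0 T, ∀ U ∈ H10 Ω, ∀ V ∈ H10 Ω,
      |b.form s r U V| ≤ CB * (‖U.2‖ * ‖V.2‖))
    {u : ℕ → L2 Ω × L2Vec Ω} (hu : ∀ n ≤ N, u n ∈ H10 Ω) {n : ℕ} (hn : n < N) :
    ∑ j ∈ Finset.Icc 1 n, step T δ N (j + 1) * quadForm b T δ N u (n + 1) j (u (n + 1)) ≤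
      CB * (1 + δ * 2 ^ (δ - 1)) * ‖(u (n + 1)).2‖ * ∑ i ∈ Finset.range n,
        (node T δ N (i + 1) - node T δ N i) * ‖(u (i + 1)).2‖ := by
  have ht := isConvexMesh_node hT hδ hN
  rw [← Finset.Ico_add_one_right_eq_Icc, Finset.sum_Ico_eq_sum_range, Nat.add_sub_cancel]
  set h : ℕ → ℝ := fun i => (node T δ N (i + 1) - node T δ N i) * ‖(u (i + 1)).2‖ with hh
  have h0 : ∀ i, 0 ≤ h i := fun i => mul_nonneg (ht.step_pos i).le (norm_nonneg _)
  have hterm : ∀ i ∈ Finset.range n,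
      step T δ N (1 + i + 1) * quadForm b T δ N u (n + 1) (1 + i) (u (n + 1)) ≤
      CB * ‖(u (n + 1)).2‖ * (δ * 2 ^ (δ - 1) * h i + if i + 1 < n then h (i + 1) else 0) := by
    intro i hi
    have hq := (le_abs_self _).trans
      (abs_quadForm_le hT hδ hN hCB hB hu hn (Finset.mem_range.1 hi))
    have hτ := ht.step_pos (i + 1)
    rw [add_comm 1 i, step_succ]
    refine (mul_le_mul_of_nonneg_left hq hτ.le).trans ?_
    rw [mul_left_comm]
    refine mul_le_mul_of_nonneg_left ?_ (by positivity)
    rw [mul_add, mul_ite, mul_zero]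
    refine add_le_add ?_ le_rfl
    simp only [hh]
    rw [← mul_assoc]
    exact mul_le_mul_of_nonneg_right (ht.step_ratio i) (norm_nonneg _)
  have hshift : ∑ i ∈ Finset.range n, (if i + 1 < n then h (i + 1) else 0) ≤
      ∑ i ∈ Finset.range n, h i := by
    rcases n with _ | k
    · simp
    · rw [Finset.sum_range_succ, if_neg (lt_irrefl _), add_zero, Finset.sum_range_succ']
      refine le_trans (Finset.sum_le_sum fun i _ => ?_) (le_add_of_nonneg_right (h0 0))
      split_ifs
      exacts [le_rfl, h0 _]
  refine (Finset.sum_le_sum hterm).trans ?_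
  rw [← Finset.mul_sum, Finset.sum_add_distrib, ← Finset.mul_sum]
  calc _ ≤ CB * ‖(u (n + 1)).2‖ * (δ * 2 ^ (δ - 1) * ∑ i ∈ Finset.range n, h i +
        ∑ i ∈ Finset.range n, h i) := by gcongr
    _ = _ := by ring

lemma sq_sum_step_mul_le {t : ℕ → ℝ} {ρ : ℝ} (ht : IsConvexMesh t ρ) {n : ℕ} (hn : t n ≤ T)
    (g : ℕ → ℝ) :
    (∑ i ∈ Finset.range n, (t (i + 1) - t i) * g (i + 1)) ^ 2 ≤
      T * ∑ i ∈ Finset.range n, (t (i + 1) - t i) * g (i + 1) ^ 2 := by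
  refine (Finset.sum_sq_le_sum_mul_sum_of_sq_le_mul _ (f := fun i => t (i + 1) - t i)
    (g := fun i => (t (i + 1) - t i) * g (i + 1) ^ 2) (fun i _ => (ht.step_pos i).le)
    (fun i _ => mul_nonneg (ht.step_pos i).le (sq_nonneg _)) (fun i _ => le_of_eq (by ring))).trans ?_
  rw [Finset.sum_range_sub, ht.zero, sub_zero]
  exact mul_le_mul_of_nonneg_right hn
    (Finset.sum_nonneg fun i _ => mul_nonneg (ht.step_pos i).le (sq_nonneg _))

lemma mul_le_quarter_mul_sq_add {m x y : ℝ} (hm : 0 < m) : x * y ≤ m / 4 * x ^ 2 + y ^ 2 / m := by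
  have h : m / 4 * x ^ 2 + y ^ 2 / m - x * y = (m * x - 2 * y) ^ 2 / (4 * m) := by
    field_simp; ring
  have := div_nonneg (sq_nonneg (m * x - 2 * y)) (by positivity : 0 ≤ 4 * m)
  linarith

/-- Testing the scheme with `u^{n+1}` itself. The source and memory terms are absorbed into half of
the dissipation `m0 ‖∇u^{n+1}‖²`; in the implicit first step the memory term is absorbed because
`τ_1` is small. -/
lemma IsDiscreteSolution.energy_inequality (hT : 0 < T) (hα0 : 0 < α) (hα1 : α < 1) (hδ : 1 ≤ δ)
    (hN : 1 ≤ N) (hm0 : 0 < m0) {b : MemoryCoeffs d}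
    (hP : ∀ U ∈ H10 Ω, ‖U.1‖ ≤ CP * ‖U.2‖)
    (hCB : 0 < CB) (hB : ∀ s ∈ Icc 0 T, ∀ r ∈ Icc 0 T, ∀ U ∈ H10 Ω, ∀ V ∈ H10 Ω,
      |b.form s r U V| ≤ CB * (‖U.2‖ * ‖V.2‖))
    (hτ : step T δ N 1 ≤ m0 / (4 * CB)) {M : ℝ → ℝ} (hM : ∀ s, 0 ≤ s → m0 ≤ M s)
    {f : ℝ → L2 Ω} {u0 : L2 Ω × L2Vec Ω} {X : Submodule ℝ (L2 Ω × L2Vec Ω)} (hX : X ≤ H10 Ω)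
    {fh u : ℕ → L2 Ω × L2Vec Ω} (hu : IsDiscreteSolution α T δ N M b f u0 X fh u) {F : ℝ}
    (hF0 : 0 ≤ F) (hF : ∀ n, 1 ≤ n → n ≤ N → ‖f (node T δ N n)‖ ≤ F) {n : ℕ} (hn : n < N) :
    caputo α (node T δ N) (fun k => ‖(u k).1‖ ^ 2) (n + 1) + m0 * ‖(u (n + 1)).2‖ ^ 2 ≤
      2 * (F * CP) ^ 2 / m0 + 2 * (CB * (1 + δ * 2 ^ (δ - 1))) ^ 2 * T / m0 *
        ∑ i ∈ Finset.range n,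
          (node T δ N (i + 1) - node T δ N i) * ‖(u (i + 1)).2‖ ^ 2 := by
  have ht := isConvexMesh_node hT hδ hN
  have hmem : ∀ k ≤ N, u k ∈ X := fun k hk => by
    rcases Nat.eq_zero_or_pos k with rfl | h
    · exact hu.initial.1
    · exact hu.mem k h hk
  have hH : ∀ k ≤ N, u k ∈ H10 Ω := fun k hk => hX (hmem k hk)
  have hcap := caputo_norm_sq_le hα0 hα1 ht (fun k => (u k).1) n
  rw [← discreteCaputo_eq_sum hα1] at hcap
  have hsrc : inner ℝ (fh (n + 1)).1 (u (n + 1)).1 ≤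
      m0 / 4 * ‖(u (n + 1)).2‖ ^ 2 + (F * CP) ^ 2 / m0 := by
    rw [(hu.source (n + 1) (by omega) hn).2 _ (hmem _ hn)]
    refine (real_inner_le_norm _ _).trans (le_trans ?_ (mul_le_quarter_mul_sq_add hm0))
    calc _ ≤ F * (CP * ‖(u (n + 1)).2‖) :=
          mul_le_mul (hF _ (by omega) hn) (hP _ (hH _ hn)) (norm_nonneg _) hF0
      _ = _ := by ring
  have hdiss : ∀ s, 0 ≤ s → m0 * ‖(u (n + 1)).2‖ ^ 2 ≤
      M s * inner ℝ (u (n + 1)).2 (u (n + 1)).2 := fun s hs => by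
    rw [real_inner_self_eq_norm_sq]
    exact mul_le_mul_of_nonneg_right (hM s hs) (sq_nonneg _)
  rcases Nat.eq_zero_or_pos n with rfl | hn0
  · have heq := hu.first _ (hmem 1 hn)
    have h1 := hdiss (‖(u 1).2‖ ^ 2) (sq_nonneg _)
    have hmem1 := node_mem_Icc hT hδ hN hn
    have h2 := (le_abs_self _).trans (hB _ hmem1 _ hmem1 _ (hH 1 hn) _ (hH 1 hn))
    have hτ0 : 0 < step T δ N 1 := by
      rw [step_succ]; exact ht.step_pos 0
    have h3 : step T δ N 1 * b.form (node T δ N 1) (node T δ N 1) (u 1) (u 1) ≤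
        m0 / 4 * ‖(u 1).2‖ ^ 2 := by
      calc _ ≤ step T δ N 1 * (CB * (‖(u 1).2‖ * ‖(u 1).2‖)) := by
            gcongr
        _ ≤ m0 / (4 * CB) * (CB * (‖(u 1).2‖ * ‖(u 1).2‖)) := by gcongr
        _ = _ := by field_simp
    simp only [zero_add] at hcap hsrc h1 ⊢
    rw [Finset.range_zero, Finset.sum_empty, mul_zero, add_zero]
    have : 2 * (F * CP) ^ 2 / m0 = 2 * ((F * CP) ^ 2 / m0) := by ring
    linarith
  · have heq := hu.later (n + 1) (by omega) hn _ (hmem _ hn)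
    have h1 := hdiss (‖(extrapolation T δ N u (n + 1)).2‖ ^ 2) (sq_nonneg _)
    rw [Nat.add_sub_cancel] at heq
    have h2 := sum_quadForm_le hT hδ hN hCB.le hB hH hn
    set R := ∑ i ∈ Finset.range n, (node T δ N (i + 1) - node T δ N i) * ‖(u (i + 1)).2‖ with hR
    have h3 : CB * (1 + δ * 2 ^ (δ - 1)) * ‖(u (n + 1)).2‖ * R ≤
        m0 / 4 * ‖(u (n + 1)).2‖ ^ 2 + (CB * (1 + δ * 2 ^ (δ - 1)) * R) ^ 2 / m0 := by
      refine le_trans (le_of_eq ?_) (mul_le_quarter_mul_sq_add hm0)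
      ring
    have h4 := sq_sum_step_mul_le ht (node_mem_Icc hT hδ hN hn.le).2 (fun k => ‖(u k).2‖)
    rw [← hR] at h4
    have h5 : (CB * (1 + δ * 2 ^ (δ - 1)) * R) ^ 2 / m0 ≤
        (CB * (1 + δ * 2 ^ (δ - 1))) ^ 2 * T / m0 * ∑ i ∈ Finset.range n,
          (node T δ N (i + 1) - node T δ N i) * ‖(u (i + 1)).2‖ ^ 2 := by
      rw [mul_pow, div_mul_eq_mul_div, mul_assoc _ T]
      gcongr
    have e1 : 2 * (F * CP) ^ 2 / m0 = 2 * ((F * CP) ^ 2 / m0) := by ring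
    have e2 : 2 * (CB * (1 + δ * 2 ^ (δ - 1))) ^ 2 * T / m0 =
      2 * ((CB * (1 + δ * 2 ^ (δ - 1))) ^ 2 * T / m0) := by ring
    rw [e1, e2, mul_assoc 2 (_ / _)]
    linarith

lemma IsRitzProjection.norm_le {X : Submodule ℝ (L2 Ω × L2Vec Ω)} {U R : L2 Ω × L2Vec Ω}
    (h : IsRitzProjection X U R) : ‖R.2‖ ≤ ‖U.2‖ := by
  have h1 := h.2 R h.1
  rw [real_inner_self_eq_norm_sq] at h1
  have h2 : ‖R.2‖ * ‖R.2‖ ≤ ‖U.2‖ * ‖R.2‖ := by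
    rw [← pow_two, h1]; exact real_inner_le_norm _ _
  rcases (norm_nonneg R.2).eq_or_lt with h0 | h0
  · rw [← h0]; exact norm_nonneg _
  · exact le_of_mul_le_mul_right h2 h0

end Energy

end KirchhoffL1

end

theorem mainTheorem8 {d : ℕ} (hd : 1 ≤ d) (Ω : Set (KirchhoffL1.Eucl d))
    (hΩ_open : IsOpen Ω) (hΩ_nonempty : Ω.Nonempty) (hΩ_convex : Convex ℝ Ω)
    (hΩ_bounded : Bornology.IsBounded Ω)
    (T : ℝ) (hT : 0 < T) (α : ℝ) (hα0 : 0 < α) (hα1 : α < 1)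
    (b : KirchhoffL1.MemoryCoeffs d) (hb : b.Admissible Ω T)
    (m0 : ℝ) (hm0 : 0 < m0) :
    ∃ τmax : ℝ, 0 < τmax ∧ ∀ δ : ℝ, 1 ≤ δ → ∃ C : ℝ, 0 < C ∧
      ∀ (M : ℝ → ℝ) (u0 : KirchhoffL1.L2 Ω × KirchhoffL1.L2Vec Ω) (f : ℝ → KirchhoffL1.L2 Ω),
        KirchhoffL1.AssumptionA1 Ω T u0 f →
        KirchhoffL1.AssumptionA2 T m0 M u0 f →
        ∀ S : Geometry.SimplicialComplex ℝ (KirchhoffL1.Eucl d),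
          KirchhoffL1.IsTriangulation Ω S →
          ∀ (N : ℕ) (hN : 1 ≤ N), KirchhoffL1.step T δ N 1 ≤ τmax →
            ∀ fh u : ℕ → KirchhoffL1.L2 Ω × KirchhoffL1.L2Vec Ω,
              KirchhoffL1.IsDiscreteSolution α T δ N M b f u0
                (KirchhoffL1.feSpace Ω S) fh u →
              (Finset.Icc 1 N).sup' (Finset.nonempty_Icc.mpr hN)
                  (fun n => KirchhoffL1.weightedNorm α T δ N n (u n))
                ≤ C * (‖u0.2‖ + (Finset.Icc 1 N).sup' (Finset.nonempty_Icc.mpr hN)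
                  (fun n => ‖f (KirchhoffL1.node T δ N n)‖)) := by
  obtain ⟨CP, hCP, hP⟩ := KirchhoffL1.exists_norm_le_mul_norm_gradient hd hΩ_bounded
  obtain ⟨CB, hCB, hB⟩ := KirchhoffL1.exists_abs_form_le hd hΩ_open hΩ_bounded hb
  -- only the implicit first step restricts the mesh: `τ_1 CB` has to be absorbed by `m0`
  refine ⟨m0 / (4 * CB), by positivity, fun δ hδ => ?_⟩
  have hδ0 : 0 < δ := by linarith
  obtain ⟨C, hC, hstab⟩ := KirchhoffL1.energy_stability (ρ := δ * 2 ^ (δ - 1)) (c₀ := m0)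
    (c₁ := 2 * (CB * (1 + δ * 2 ^ (δ - 1))) ^ 2 * T / m0) hα0 hα1 hT (by positivity) hm0
    (by positivity)
  refine ⟨2 * Real.sqrt (C * (2 * CP ^ 2 / m0 + CP ^ 2)), by positivity, ?_⟩
  intro M u0 f _ hA2 S _ N hN hτ fh u hu
  set F := (Finset.Icc 1 N).sup' (Finset.nonempty_Icc.mpr hN)
    (fun n => ‖f (KirchhoffL1.node T δ N n)‖)
  have hF : ∀ n, 1 ≤ n → n ≤ N → ‖f (KirchhoffL1.node T δ N n)‖ ≤ F := fun n h1 h2 =>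
    Finset.le_sup' (fun n => ‖f (KirchhoffL1.node T δ N n)‖) (Finset.mem_Icc.2 ⟨h1, h2⟩)
  have hF0 : 0 ≤ F := (norm_nonneg _).trans (hF 1 le_rfl hN)
  have hX : KirchhoffL1.feSpace Ω S ≤ KirchhoffL1.H10 Ω := fun U hU => hU.1
  have ht := KirchhoffL1.isConvexMesh_node hT hδ hN
  have hbound := hstab _ ht N (KirchhoffL1.node_last T δ hN).le (fun k => ‖(u k).1‖ ^ 2)
    (fun k => ‖(u k).2‖ ^ 2) (2 * (F * CP) ^ 2 / m0) (fun _ => sq_nonneg _)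
    (fun _ => sq_nonneg _) (by positivity)
    (fun n hn => hu.energy_inequality hT hα0 hα1 hδ hN hm0 hP hCB hB hτ
      (fun s hs => hA2.le_of_nonneg hs) hX hF0 hF hn)
  have hdata : 2 * (F * CP) ^ 2 / m0 + ‖(u 0).1‖ ^ 2 ≤
      (2 * CP ^ 2 / m0 + CP ^ 2) * (‖u0.2‖ + F) ^ 2 := by
    have h0 : ‖(u 0).1‖ ≤ CP * ‖u0.2‖ :=
      (hP _ (hX hu.initial.1)).trans (mul_le_mul_of_nonneg_left hu.initial.norm_le hCP.le)
    have hF2 : F ^ 2 ≤ (‖u0.2‖ + F) ^ 2 := by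
      gcongr; exact le_add_of_nonneg_left (norm_nonneg _)
    have hG2 : ‖u0.2‖ ^ 2 ≤ (‖u0.2‖ + F) ^ 2 := by
      gcongr; exact le_add_of_nonneg_right hF0
    calc _ ≤ 2 * (F * CP) ^ 2 / m0 + (CP * ‖u0.2‖) ^ 2 := by gcongr
      _ = 2 * CP ^ 2 / m0 * F ^ 2 + CP ^ 2 * ‖u0.2‖ ^ 2 := by ring
      _ ≤ 2 * CP ^ 2 / m0 * (‖u0.2‖ + F) ^ 2 + CP ^ 2 * (‖u0.2‖ + F) ^ 2 := by gcongr
      _ = _ := by ring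
  have hsqrt : ∀ x : ℝ, x ^ 2 ≤ C * (2 * (F * CP) ^ 2 / m0 + ‖(u 0).1‖ ^ 2) →
      x ≤ Real.sqrt (C * (2 * CP ^ 2 / m0 + CP ^ 2)) * (‖u0.2‖ + F) := by
    intro x hx
    refine le_of_sq_le_sq (hx.trans ?_) (by positivity)
    rw [mul_pow (Real.sqrt _), Real.sq_sqrt (by positivity), mul_assoc]
    exact mul_le_mul_of_nonneg_left hdata hC.le
  refine Finset.sup'_le _ _ fun n hn => ?_
  obtain ⟨h1, h2⟩ := Finset.mem_Icc.1 hn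
  obtain ⟨n, rfl⟩ : ∃ k, n = k + 1 := ⟨n - 1, by omega⟩
  obtain ⟨hV, ha⟩ := hbound n h2
  have e1 := hsqrt _ hV
  have e2 := hsqrt (KirchhoffL1.step T δ N (n + 1) ^ (α / 2) * ‖(u (n + 1)).2‖) (by
    rw [mul_pow, ← Real.rpow_mul_natCast (by rw [KirchhoffL1.step_succ]; exact (ht.step_pos n).le),
      Nat.cast_ofNat, div_mul_cancel₀ _ two_ne_zero, KirchhoffL1.step_succ]
    exact ha)
  rw [KirchhoffL1.weightedNorm]
  linarith
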